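/- Let $E$ be a (real) disjointly homogeneous Banach lattice with order continuous norm and a weak unit; that is, for any two sequences $(x_n)$, $(y_n)$ of pairwise disjoint norm-one elements of $E$ there are $C>0$ and indices $n_1<n_2<\cdots$ such that $$C^{-1}\Big\|\sum_k a_k y_{n_k}\Big\|\le\Big\|\sum_k a_k x_{n_k}\Big\|\le C\Big\|\sum_k a_k y_{n_k}\Big\|$$ for all finitely supported scalar sequences $(a_k)$. Let $S$ and $T$ be two regular operators on $E$ (differences of two positive bounded linear operators $E\to E$) such that $S$ is disjointly strictly singular (for no sequence $(x_n)$ of pairwise disjoint nonzero elements of $E$ is the restriction of $S$ to the closed linear span $[x_n]$ an isomorphism onto its image) and $T$ is AM-compact ($T(\{y\in E:|y|\le x\})$ is relatively compact for every $x\ge 0$ in $E$). 1. If the dual Banach lattice $E^*$ has order continuous norm, then $ST$ is compact. 2. If the norm of $E^*$ is not order continuous, then $TS$ is compact. In particular, if $R$ is any regular disjointly strictly singular operator on $E$, then $STR$ is compact. -/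

import Mathlib

namespace BanachLattice

/-- The norm of an ordered normed group is order continuous: every downward directed set
(equivalently, every decreasing net) with infimum `0` has elements of arbitrarily small norm.
For a Banach lattice this says that `x_α ↓ 0` implies `‖x_α‖ → 0`. -/
def OrderContinuousNorm (α : Type*) [NormedAddCommGroup α] [Preorder α] : Prop :=
  ∀ D : Set α, D.Nonempty → DirectedOn (fun a b => b ≤ a) D → IsGLB D 0 →
    ∀ ε : ℝ, 0 < ε → ∃ d ∈ D, ‖d‖ < ε

/-- A weak (order) unit: a positive element `e` such that only `0` is disjoint from it. -/
def IsWeakUnit {α : Type*} [AddCommGroup α] [Lattice α] (e : α) : Prop :=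
  0 ≤ e ∧ ∀ x : α, e ⊓ |x| = 0 → x = 0

/-- A sequence of pairwise disjoint elements: `|x n| ∧ |x m| = 0` for `n ≠ m`. -/
def DisjointSeq {α : Type*} [AddCommGroup α] [Lattice α] (x : ℕ → α) : Prop :=
  ∀ n m : ℕ, n ≠ m → |x n| ⊓ |x m| = 0

/-- Two sequences are `C`-equivalent:
`C⁻¹ ‖∑ aₙ yₙ‖ ≤ ‖∑ aₙ xₙ‖ ≤ C ‖∑ aₙ yₙ‖` for all finitely supported scalars. -/
def EquivSeq {X Y : Type*} [NormedAddCommGroup X] [NormedSpace ℝ X]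
    [NormedAddCommGroup Y] [NormedSpace ℝ Y] (C : ℝ) (x : ℕ → X) (y : ℕ → Y) : Prop :=
  ∀ (N : ℕ) (a : ℕ → ℝ),
    C⁻¹ * ‖∑ n ∈ Finset.range N, a n • y n‖ ≤ ‖∑ n ∈ Finset.range N, a n • x n‖ ∧
    ‖∑ n ∈ Finset.range N, a n • x n‖ ≤ C * ‖∑ n ∈ Finset.range N, a n • y n‖

section

variable (E : Type*) [NormedAddCommGroup E] [NormedSpace ℝ E] [Lattice E]

/-- Disjointly homogeneous (DH): any two normalized disjoint sequences have equivalent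
subsequences, taken along a common sequence of indices. -/
def DisjointlyHomogeneous : Prop :=
  ∀ x y : ℕ → E, (∀ n, ‖x n‖ = 1) → (∀ n, ‖y n‖ = 1) → DisjointSeq x → DisjointSeq y →
    ∃ C : ℝ, 0 < C ∧ ∃ φ : ℕ → ℕ, StrictMono φ ∧ EquivSeq C (x ∘ φ) (y ∘ φ)

/-- The order of the Banach lattice dual: `f ≤ g` iff `f x ≤ g x` for all `x ≥ 0`. -/
abbrev dualOrder [IsOrderedAddMonoid E] : PartialOrder (StrongDual ℝ E) where
  le f g := ∀ x : E, 0 ≤ x → f x ≤ g x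
  le_refl _ _ _ := le_rfl
  le_trans _ _ _ h₁ h₂ x hx := (h₁ x hx).trans (h₂ x hx)
  le_antisymm f g h₁ h₂ := by
    ext x
    have key : ∀ z : E, 0 ≤ z → f z = g z := fun z hz => le_antisymm (h₁ z hz) (h₂ z hz)
    rw [← posPart_sub_negPart x, map_sub, map_sub, key _ (posPart_nonneg x),
      key _ (negPart_nonneg x)]

/-- The norm of the dual `E*`, with its dual norm and dual order, is order continuous. -/
def DualOrderContinuous [IsOrderedAddMonoid E] : Prop :=
  letI := dualOrder E
  OrderContinuousNorm (StrongDual ℝ E)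

end

section

variable {E : Type*} [NormedAddCommGroup E] [NormedSpace ℝ E] [Lattice E]

/-- A regular operator: a difference of two positive operators. -/
def IsRegularOp {F : Type*} [NormedAddCommGroup F] [NormedSpace ℝ F] [Lattice F]
    (T : E →L[ℝ] F) : Prop :=
  ∃ P Q : E →L[ℝ] F, (∀ x, 0 ≤ x → 0 ≤ P x) ∧ (∀ x, 0 ≤ x → 0 ≤ Q x) ∧ T = P - Q

variable {X : Type*} [NormedAddCommGroup X] [NormedSpace ℝ X]

/-- Disjointly strictly singular (DSS): on the closed linear span of any sequence of pairwise
disjoint nonzero elements, the operator is not bounded below, i.e. its restriction is not an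
isomorphism onto its image. -/
def IsDSS (T : E →L[ℝ] X) : Prop :=
  ∀ x : ℕ → E, (∀ n, x n ≠ 0) → DisjointSeq x →
    ¬ ∃ c : ℝ, 0 < c ∧
      ∀ v ∈ (Submodule.span ℝ (Set.range x)).topologicalClosure, c * ‖v‖ ≤ ‖T v‖

/-- AM-compact: the image of every order interval `{y | |y| ≤ x}` is relatively compact. -/
def IsAMCompact (T : E →L[ℝ] X) : Prop :=
  ∀ x : E, 0 ≤ x → IsCompact (closure (T '' {y : E | |y| ≤ x}))

end

end BanachLattice

namespace BanachLattice

set_option linter.unusedSectionVars false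

open Filter Topology

/-! ### Disjointness and absolute values in lattice-ordered groups -/

section Lattice

variable {E : Type*} [AddCommGroup E] [Lattice E] [IsOrderedAddMonoid E]

/-! Both cases reduce an operator to its action on order intervals, where AM-compactness of `T`
gives total boundedness. The obstruction to such a reduction is always a disjoint sequence, produced
by `exists_disjointSeq_posPart`.

If `E*` has order continuous norm, positive functionals tend to zero along bounded disjoint
sequences. A regular operator is dominated by a positive one, so order continuity of `E` makes the
images of such a sequence vanish in norm after truncation, and by Kadec–Pełczyński some of them are
nearly disjoint (`exists_subseq_near_disjoint`). Were the images under `S` bounded away from zero,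
disjoint homogeneity would compare them with the original vectors and make `S` bounded below on a
disjoint span. Hence `S` sends bounded disjoint sequences to norm null ones; since `T` keeps a
subsequence nearly disjoint, `ST` does the same, and `exists_orderInterval_approx` applies.

If the norm of `E*` is not order continuous, some disjoint sequence behaves like the `ℓ¹` basis, and
by disjoint homogeneity every normalized disjoint sequence has such a subsequence. If the image of
the unit ball under `S` were not almost order bounded, it would yield disjoint minorants of `|S x|`
that are large in norm. Their `ℓ¹` behaviour supplies a positive functional whose disjoint
components detect them. Disjointifying the arguments too and applying Rosenthal's lemma makes `S`
bounded below on a disjoint `ℓ¹` span. So the image is almost order bounded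
(`IsDSS.exists_almostOrderBound`) and `T` turns it into a relatively compact set. -/

theorem add_inf_le {x y z : E} (hx : 0 ≤ x) (hy : 0 ≤ y) (hz : 0 ≤ z) :
    (x + y) ⊓ z ≤ x ⊓ z + y ⊓ z := by
  rw [inf_add, add_inf, add_inf]
  refine le_inf (le_inf inf_le_left ?_) (le_inf ?_ ?_)
  · exact inf_le_right.trans (le_add_of_nonneg_left hx)
  · exact inf_le_right.trans (le_add_of_nonneg_right hy)
  · exact inf_le_right.trans (le_add_of_nonneg_right hz)

theorem inf_eq_zero_mono {a b c d : E} (ha : 0 ≤ a) (hb : 0 ≤ b) (hac : a ≤ c) (hbd : b ≤ d)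
    (h : c ⊓ d = 0) : a ⊓ b = 0 :=
  le_antisymm (h ▸ inf_le_inf hac hbd) (le_inf ha hb)

theorem inf_add_eq_zero {a b c : E} (ha : 0 ≤ a) (hb : 0 ≤ b) (hc : 0 ≤ c)
    (hab : a ⊓ b = 0) (hac : a ⊓ c = 0) : a ⊓ (b + c) = 0 := by
  refine le_antisymm ?_ (le_inf ha (add_nonneg hb hc))
  rw [inf_comm]
  refine (add_inf_le hb hc ha).trans ?_
  rw [inf_comm b, inf_comm c, hab, hac, add_zero]

theorem inf_sum_eq_zero {ι : Type*} {a : E} {f : ι → E} (s : Finset ι) (ha : 0 ≤ a)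
    (hf : ∀ i, 0 ≤ f i) (h : ∀ i ∈ s, a ⊓ f i = 0) : a ⊓ ∑ i ∈ s, f i = 0 := by
  classical
  induction s using Finset.induction_on with
  | empty => simpa using ha
  | insert i s his ih =>
    rw [Finset.sum_insert his]
    exact inf_add_eq_zero ha (hf i) (Finset.sum_nonneg fun j _ => hf j)
      (h i (Finset.mem_insert_self i s)) (ih fun j hj => h j (Finset.mem_insert_of_mem hj))

theorem add_le_of_inf_eq_zero {a b y : E} (h : a ⊓ b = 0) (ha : a ≤ y) (hb : b ≤ y) :
    a + b ≤ y := by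
  rw [← inf_add_sup, h, zero_add]
  exact sup_le ha hb

theorem sum_le_of_disjoint {ι : Type*} {f : ι → E} (s : Finset ι) {y : E} (hy : 0 ≤ y)
    (hf : ∀ i, 0 ≤ f i) (h : ∀ i j, i ≠ j → f i ⊓ f j = 0) (hfy : ∀ i, f i ≤ y) :
    ∑ i ∈ s, f i ≤ y := by
  classical
  induction s using Finset.induction_on with
  | empty => simpa using hy
  | insert i s his ih =>
    rw [Finset.sum_insert his]
    refine add_le_of_inf_eq_zero (inf_sum_eq_zero s (hf i) hf fun j hj => h i j ?_) (hfy i) ih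
    rintro rfl
    exact his hj

/-- For the lower bound, `|x + y|` dominates `||x| - |y||`, which is supremum minus infimum; with
zero infimum the supremum is the sum. -/
theorem abs_add_of_disjoint {x y : E} (h : |x| ⊓ |y| = 0) : |x + y| = |x| + |y| := by
  refine le_antisymm (abs_add_le x y) ?_
  have h1 := abs_abs_sub_abs_le x (-y)
  rw [abs_neg, sub_neg_eq_add, ← sup_sub_inf_eq_abs_sub, inf_comm |y|, h, sub_zero] at h1
  rwa [← inf_add_sup, h, zero_add, sup_comm]

theorem abs_sum_le' {ι : Type*} (f : ι → E) (s : Finset ι) :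
    |∑ i ∈ s, f i| ≤ ∑ i ∈ s, |f i| := by
  classical
  induction s using Finset.induction_on with
  | empty => simp
  | insert i s his ih =>
    rw [Finset.sum_insert his, Finset.sum_insert his]
    exact (abs_add_le _ _).trans (add_le_add le_rfl ih)

theorem abs_sum_of_disjoint {ι : Type*} {f : ι → E} (s : Finset ι)
    (h : ∀ i j, i ≠ j → |f i| ⊓ |f j| = 0) : |∑ i ∈ s, f i| = ∑ i ∈ s, |f i| := by
  classical
  induction s using Finset.induction_on with
  | empty => simp
  | insert i s his ih =>
    rw [Finset.sum_insert his, Finset.sum_insert his, abs_add_of_disjoint, ih]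
    rw [ih]
    refine inf_sum_eq_zero s (abs_nonneg _) (fun _ => abs_nonneg _) fun j hj => h i j ?_
    rintro rfl
    exact his hj

theorem posPart_le_abs (x : E) : x⁺ ≤ |x| := by
  rw [← posPart_add_negPart]
  exact le_add_of_nonneg_right (negPart_nonneg x)

theorem negPart_le_abs (x : E) : x⁻ ≤ |x| := by
  rw [← posPart_add_negPart]
  exact le_add_of_nonneg_left (posPart_nonneg x)

theorem sub_posPart_sub (x u : E) : x - (x - u)⁺ = x ⊓ u := by
  rw [inf_eq_sub_posPart_sub]

theorem sub_inf_eq (x u : E) : x - x ⊓ u = (x - u)⁺ := by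
  rw [inf_eq_sub_posPart_sub, sub_sub_cancel]

theorem inf_add_le_inf_add {x u r : E} (hr : 0 ≤ r) : x ⊓ (u + r) ≤ x ⊓ u + r := by
  rw [inf_add]
  exact inf_le_inf (le_add_of_nonneg_right hr) le_rfl

theorem DisjointSeq.comp {x : ℕ → E} (h : DisjointSeq x) {φ : ℕ → ℕ} (hφ : φ.Injective) :
    DisjointSeq (x ∘ φ) := fun _ _ hnm => h _ _ (hφ.ne hnm)

theorem DisjointSeq.mono {x y : ℕ → E} (h : DisjointSeq x) (hxy : ∀ n, |y n| ≤ |x n|) :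
    DisjointSeq y := fun n m hnm =>
  inf_eq_zero_mono (abs_nonneg _) (abs_nonneg _) (hxy n) (hxy m) (h n m hnm)

end Lattice

/-! ### Real scalars and disjointness -/

section Module

variable {E : Type*} [AddCommGroup E] [Lattice E] [IsOrderedAddMonoid E] [Module ℝ E]
  [IsOrderedModule ℝ E]

theorem smul_inf_of_pos {c : ℝ} (hc : 0 < c) (x y : E) : c • (x ⊓ y) = c • x ⊓ c • y :=
  (OrderIso.smulRight hc : E ≃o E).map_inf x y

theorem abs_smul_real (c : ℝ) (x : E) : |c • x| = |c| • |x| := by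
  have key : ∀ {c : ℝ}, 0 < c → ∀ x : E, |c • x| = c • |x| := fun {c} hc x => by
    have := (OrderIso.smulRight hc : E ≃o E).map_sup x (-x)
    simp only [OrderIso.smulRight_apply, smul_neg] at this
    exact this.symm
  rcases lt_trichotomy c 0 with h | h | h
  · rw [abs_of_neg h, ← key (neg_pos.2 h), neg_smul, abs_neg]
  · simp [h]
  · rw [abs_of_pos h, key h]

theorem smul_inf_smul_eq_zero {x y : E} (hx : 0 ≤ x) (hy : 0 ≤ y) (h : x ⊓ y = 0) {a b : ℝ}
    (ha : 0 ≤ a) (hb : 0 ≤ b) : a • x ⊓ b • y = 0 := by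
  set M := max 1 (max a b)
  have hM : 0 < M := lt_of_lt_of_le one_pos (le_max_left _ _)
  refine inf_eq_zero_mono (c := M • x) (d := M • y) (smul_nonneg ha hx) (smul_nonneg hb hy)
    (smul_le_smul_of_nonneg_right ((le_max_left _ _).trans (le_max_right _ _)) hx)
    (smul_le_smul_of_nonneg_right ((le_max_right _ _).trans (le_max_right _ _)) hy) ?_
  rw [← smul_inf_of_pos hM, h, smul_zero]

theorem DisjointSeq.smul {x : ℕ → E} (h : DisjointSeq x) (a : ℕ → ℝ) :
    DisjointSeq fun n => a n • x n := fun n m hnm => by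
  simp only [abs_smul_real]
  exact smul_inf_smul_eq_zero (abs_nonneg _) (abs_nonneg _) (h n m hnm) (abs_nonneg _)
    (abs_nonneg _)

theorem DisjointSeq.abs_sum_smul {x : ℕ → E} (h : DisjointSeq x) (a : ℕ → ℝ) (s : Finset ℕ) :
    |∑ n ∈ s, a n • x n| = ∑ n ∈ s, |a n| • |x n| := by
  rw [abs_sum_of_disjoint s (h.smul a)]
  simp_rw [abs_smul_real]

/-- Since `d ≥ c⁻¹`, the second positive part is at most `c⁻¹` times the negative part of `x - c •
y`, which is disjoint from its positive part. -/
theorem posPart_sub_smul_inf_eq_zero {x y : E} {c d : ℝ} (hc : 0 < c)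
    (h : 1 ≤ c * d) (hx : 0 ≤ x) : (x - c • y)⁺ ⊓ (y - d • x)⁺ = 0 := by
  have h1 : (y - d • x)⁺ ≤ c⁻¹ • (x - c • y)⁻ := by
    refine sup_le ?_ (smul_nonneg (inv_nonneg.2 hc.le) (negPart_nonneg _))
    have h2 : c⁻¹ • (-(x - c • y)) ≤ c⁻¹ • (x - c • y)⁻ :=
      smul_le_smul_of_nonneg_left (neg_le_negPart _) (inv_nonneg.2 hc.le)
    refine le_trans ?_ h2
    rw [neg_sub, smul_sub, smul_smul, inv_mul_cancel₀ hc.ne', one_smul]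
    refine sub_le_sub_left (smul_le_smul_of_nonneg_right ?_ hx) _
    rw [inv_le_iff_one_le_mul₀ hc]
    linarith [mul_comm c d]
  refine inf_eq_zero_mono (posPart_nonneg _) (posPart_nonneg _) le_rfl h1 ?_
  have := smul_inf_smul_eq_zero (posPart_nonneg (x - c • y)) (negPart_nonneg (x - c • y))
    (posPart_inf_negPart_eq_zero _) zero_le_one (inv_nonneg.2 hc.le)
  rwa [one_smul] at this

end Module

/-! ### Solid norms and disjointification -/

section Norm

variable {E : Type*} [NormedAddCommGroup E] [NormedSpace ℝ E] [Lattice E]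
  [IsOrderedAddMonoid E] [IsOrderedModule ℝ E] [HasSolidNorm E]

theorem norm_le_norm_of_nonneg_of_le {x y : E} (hx : 0 ≤ x) (h : x ≤ y) : ‖x‖ ≤ ‖y‖ :=
  norm_le_norm_of_abs_le_abs (by rwa [abs_of_nonneg hx, abs_of_nonneg (hx.trans h)])

theorem DisjointSeq.norm_sum_le {x : ℕ → E} (h : DisjointSeq x) {a b : ℕ → ℝ} {c : ℝ}
    (hc : 0 ≤ c) (s : Finset ℕ) (hab : ∀ n ∈ s, |a n| ≤ c * |b n|) :
    ‖∑ n ∈ s, a n • x n‖ ≤ c * ‖∑ n ∈ s, b n • x n‖ := by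
  have h1 : |∑ n ∈ s, a n • x n| ≤ |c • ∑ n ∈ s, b n • x n| := by
    rw [abs_smul_real, h.abs_sum_smul, h.abs_sum_smul, Finset.smul_sum]
    refine Finset.sum_le_sum fun n hn => ?_
    rw [smul_smul, abs_of_nonneg hc]
    exact smul_le_smul_of_nonneg_right (hab n hn) (abs_nonneg _)
  refine (norm_le_norm_of_abs_le_abs h1).trans ?_
  rw [norm_smul, Real.norm_of_nonneg hc]

theorem DisjointSeq.norm_smul_le {x : ℕ → E} (h : DisjointSeq x) (a : ℕ → ℝ) {s : Finset ℕ}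
    {n : ℕ} (hn : n ∈ s) : ‖a n • x n‖ ≤ ‖∑ n ∈ s, a n • x n‖ := by
  refine norm_le_norm_of_abs_le_abs ?_
  rw [h.abs_sum_smul, abs_smul_real]
  exact Finset.single_le_sum (f := fun n => |a n| • |x n|)
    (fun i _ => smul_nonneg (abs_nonneg _) (abs_nonneg _)) hn

/-- Any norm-bounded sequence of positive elements becomes disjoint after removing the part
dominated by multiples of its predecessors and a small error. -/
theorem exists_disjointSeq_posPart [CompleteSpace E] {x : ℕ → E} {C ε : ℝ} (hx : ∀ k, 0 ≤ x k)
    (hC : ∀ k, ‖x k‖ ≤ C) (hε : 0 < ε) :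
    ∃ r : ℕ → E, (∀ k, 0 ≤ r k) ∧ (∀ k, ‖r k‖ ≤ C * ε * (1 / 2) ^ k) ∧
      DisjointSeq fun k =>
        (x k - (ε⁻¹ * 2 ^ k) • ∑ i ∈ Finset.range k, x i - r k)⁺ := by
  -- The error `r k` is the tail over `n > k` of the series with terms `ε 2⁻ⁿ x n`. For `m < n` the
  -- coefficient of `x n` in `r m` is the inverse of the one with which `x m` is subtracted from `x
  -- n`, as `posPart_sub_smul_inf_eq_zero` requires.
  set y : ℕ → ℕ → E := fun k j => (ε * (1 / 2) ^ (k + 1 + j)) • x (k + 1 + j) with hy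
  have hpos : ∀ k : ℕ, 0 < ε * (1 / 2) ^ k := fun k => by positivity
  have hypos : ∀ k j, 0 ≤ y k j := fun k j => smul_nonneg (hpos _).le (hx _)
  have hbd : ∀ k j, ‖y k j‖ ≤ C * ε * (1 / 2) ^ (k + 1) * (1 / 2) ^ j := fun k j => by
    rw [hy, norm_smul, Real.norm_of_nonneg (hpos _).le, pow_add _ (k + 1)]
    have := mul_le_mul_of_nonneg_left (hC (k + 1 + j)) (hpos (k + 1 + j)).le
    rw [pow_add _ (k + 1)] at this
    refine this.trans_eq ?_
    ring
  have hgeo : ∀ k : ℕ, HasSum (fun j : ℕ => C * ε * (1 / 2) ^ (k + 1) * (1 / 2 : ℝ) ^ j)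
      (C * ε * (1 / 2) ^ k) := fun k => by
    have e : C * ε * (1 / 2) ^ k = C * ε * (1 / 2) ^ (k + 1) * 2 := by
      rw [pow_succ]
      ring
    rw [e]
    exact hasSum_geometric_two.mul_left _
  have hsum : ∀ k, Summable (y k) := fun k =>
    Summable.of_norm_bounded (hgeo k).summable (hbd k)
  refine ⟨fun k => ∑' j, y k j, fun k => tsum_nonneg (hypos k), fun k =>
    tsum_of_norm_bounded (hgeo k) (hbd k), ?_⟩
  have key : ∀ m n, m < n →
      |(x m - (ε⁻¹ * 2 ^ m) • ∑ i ∈ Finset.range m, x i - ∑' j, y m j)⁺| ⊓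
      |(x n - (ε⁻¹ * 2 ^ n) • ∑ i ∈ Finset.range n, x i - ∑' j, y n j)⁺| = 0 := by
    intro m n hmn
    rw [abs_of_nonneg (posPart_nonneg _), abs_of_nonneg (posPart_nonneg _)]
    refine inf_eq_zero_mono (posPart_nonneg _) (posPart_nonneg _)
      (c := (x m - (ε * (1 / 2) ^ n) • x n)⁺) (d := (x n - (ε⁻¹ * 2 ^ n) • x m)⁺)
      (posPart_mono ?_) (posPart_mono ?_)
      (posPart_sub_smul_inf_eq_zero (hpos n) ?_ (hx m))
    · rw [sub_sub]
      refine sub_le_sub_left ?_ _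
      have h1 : y m (n - m - 1) ≤ ∑' j, y m j :=
        (hsum m).le_tsum _ fun j _ => hypos m j
      have h2 : y m (n - m - 1) = (ε * (1 / 2) ^ n) • x n := by
        have : m + 1 + (n - m - 1) = n := by omega
        simp only [hy, this]
      rw [← h2]
      exact h1.trans (le_add_of_nonneg_left
        (smul_nonneg (by positivity) (Finset.sum_nonneg fun i _ => hx i)))
    · rw [sub_sub]
      refine sub_le_sub_left ?_ _
      refine le_trans (smul_le_smul_of_nonneg_left ?_ (by positivity))
        (le_add_of_nonneg_right (tsum_nonneg (hypos n)))
      exact Finset.single_le_sum (fun i _ => hx i) (Finset.mem_range.2 hmn)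
    · have : ε * (1 / 2) ^ n * (ε⁻¹ * 2 ^ n) = 1 := by
        field_simp
        rw [← mul_pow]; norm_num
      exact this.ge
  intro n m hnm
  rcases lt_or_gt_of_ne hnm with h | h
  · exact key n m h
  · rw [inf_comm]
    exact key m n h

end Norm

/-- Dependent choice in which each choice may depend on the list of all previous ones. -/
theorem exists_seq_of_forall_list {ι : Type*} {Q : List ι → ι → Prop} (h : ∀ l, ∃ i, Q l i) :
    ∃ f : ℕ → ι, ∀ k, Q ((List.range k).map f) (f k) := by
  choose g hg using h
  let L : ℕ → List ι := fun k => Nat.rec [] (fun _ l => l ++ [g l]) k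
  have hL : ∀ k, L k = (List.range k).map fun j => g (L j) := by
    intro k
    induction k with
    | zero => rfl
    | succ k ih =>
      rw [List.range_succ, List.map_append, ← ih]
      rfl
  refine ⟨fun k => g (L k), fun k => ?_⟩
  rw [← hL]
  exact hg _

/-! ### Positive functionals: extension, components, separation, `ℓ¹`-estimates -/

section Functionals

variable {E : Type*} [NormedAddCommGroup E] [NormedSpace ℝ E] [Lattice E]
  [IsOrderedAddMonoid E] [IsOrderedModule ℝ E] [HasSolidNorm E]

/-- A map that is positive on the positive cone. -/
def IsPositiveMap {F : Type*} [NormedAddCommGroup F] [NormedSpace ℝ F] [Preorder F]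
    (P : E →L[ℝ] F) : Prop := ∀ x, 0 ≤ x → 0 ≤ P x

namespace IsPositiveMap

variable {F : Type*} [NormedAddCommGroup F] [NormedSpace ℝ F] [Lattice F]
  [IsOrderedAddMonoid F] {P Q : E →L[ℝ] F}

theorem mono (hP : IsPositiveMap P) {x y : E} (h : x ≤ y) : P x ≤ P y := by
  have := hP (y - x) (sub_nonneg.2 h)
  rwa [map_sub, sub_nonneg] at this

theorem abs_le (hP : IsPositiveMap P) (x : E) : |P x| ≤ P |x| := by
  refine abs_le'.2 ⟨hP.mono (le_abs_self x), ?_⟩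
  rw [← map_neg]
  exact hP.mono (neg_le_abs x)

theorem add (hP : IsPositiveMap P) (hQ : IsPositiveMap Q) : IsPositiveMap (P + Q) :=
  fun x hx => add_nonneg (hP x hx) (hQ x hx)

end IsPositiveMap

theorem norm_posPart_le (x : E) : ‖x⁺‖ ≤ ‖x‖ := by
  rw [← norm_abs_eq_norm x]
  exact norm_le_norm_of_nonneg_of_le (posPart_nonneg x) (posPart_le_abs x)

theorem norm_negPart_le (x : E) : ‖x⁻‖ ≤ ‖x‖ := by
  rw [← norm_abs_eq_norm x]
  exact norm_le_norm_of_nonneg_of_le (negPart_nonneg x) (negPart_le_abs x)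

/-- Kantorovich: an additive bounded function on the positive cone extends to a bounded
functional. -/
theorem exists_strongDual_of_additive {q : E → ℝ} {M : ℝ}
    (hadd : ∀ x y, 0 ≤ x → 0 ≤ y → q (x + y) = q x + q y)
    (hM : ∀ x, 0 ≤ x → |q x| ≤ M * ‖x‖) :
    ∃ f : StrongDual ℝ E, ∀ x, 0 ≤ x → f x = q x := by
  have hq0 : q 0 = 0 := by
    have := hadd 0 0 le_rfl le_rfl
    rw [add_zero] at this
    linarith
  have hM' : ∀ x, 0 ≤ x → |q x| ≤ |M| * ‖x‖ := fun x hx =>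
    (hM x hx).trans (mul_le_mul_of_nonneg_right (le_abs_self M) (norm_nonneg x))
  let f : E →+ ℝ :=
    { toFun := fun x => q x⁺ - q x⁻
      map_zero' := by simp
      map_add' := fun x y => by
        -- Rearranged so that every term lies in the positive cone, the only place where `q` is
        -- additive.
        have h : (x + y)⁺ + (x⁻ + y⁻) = (x + y)⁻ + (x⁺ + y⁺) := by
          have h1 := posPart_sub_negPart (x + y)
          have h2 := posPart_sub_negPart x
          have h3 := posPart_sub_negPart y
          rw [eq_add_of_sub_eq h1, eq_add_of_sub_eq h2, eq_add_of_sub_eq h3]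
          abel
        have h1 := congrArg q h
        have n := fun z : E => posPart_nonneg z
        have m := fun z : E => negPart_nonneg z
        rw [hadd _ _ (n _) (add_nonneg (m _) (m _)), hadd _ _ (m _) (add_nonneg (n _) (n _)),
          hadd _ _ (m _) (m _), hadd _ _ (n _) (n _)] at h1
        linarith }
  have hf : ∀ x, ‖f x‖ ≤ (2 * |M|) * ‖x‖ := fun x => by
    have h1 := hM' _ (posPart_nonneg x)
    have h2 := hM' _ (negPart_nonneg x)
    have h3 := mul_le_mul_of_nonneg_left (norm_posPart_le x) (abs_nonneg M)
    have h4 := mul_le_mul_of_nonneg_left (norm_negPart_le x) (abs_nonneg M)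
    have h5 : ‖f x‖ ≤ |q x⁺| + |q x⁻| := abs_sub _ _
    linarith
  refine ⟨f.toRealLinearMap (AddMonoidHomClass.continuous_of_bound f _ hf), fun x hx => ?_⟩
  change q x⁺ - q x⁻ = q x
  rw [posPart_of_nonneg hx, negPart_of_nonneg hx, hq0, sub_zero]

/-- The component of a positive functional carried by a positive element `z`. -/
theorem exists_component {F : StrongDual ℝ E} (hF : IsPositiveMap F) {z : E} (hz : 0 ≤ z) :
    ∃ f : StrongDual ℝ E, ∀ x, 0 ≤ x →
      Tendsto (fun m : ℕ => F (x ⊓ (m : ℝ) • z)) atTop (𝓝 (f x)) := by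
  have hmz : ∀ m : ℕ, 0 ≤ (m : ℝ) • z := fun m => smul_nonneg m.cast_nonneg hz
  have hmono : ∀ x, Monotone fun m : ℕ => F (x ⊓ (m : ℝ) • z) := fun x m n hmn =>
    hF.mono (inf_le_inf_left _ (smul_le_smul_of_nonneg_right (Nat.cast_le.2 hmn) hz))
  have hbdd : ∀ x, BddAbove (Set.range fun m : ℕ => F (x ⊓ (m : ℝ) • z)) := fun x =>
    ⟨F x, by rintro _ ⟨m, rfl⟩; exact hF.mono inf_le_left⟩
  have hlim : ∀ x, Tendsto (fun m : ℕ => F (x ⊓ (m : ℝ) • z)) atTop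
      (𝓝 (⨆ m : ℕ, F (x ⊓ (m : ℝ) • z))) := fun x => tendsto_atTop_ciSup (hmono x) (hbdd x)
  suffices h : ∃ f : StrongDual ℝ E, ∀ x, 0 ≤ x → f x = ⨆ m : ℕ, F (x ⊓ (m : ℝ) • z) by
    obtain ⟨f, hf⟩ := h
    exact ⟨f, fun x hx => by rw [hf x hx]; exact hlim x⟩
  refine exists_strongDual_of_additive (M := ‖F‖) ?_ ?_
  · intro x y hx hy
    refine le_antisymm ?_ ?_
    · refine le_of_tendsto_of_tendsto' (hlim _) ((hlim x).add (hlim y)) fun m => ?_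
      rw [← map_add]
      exact hF.mono (add_inf_le hx hy (hmz m))
    · refine le_of_tendsto' ((hlim x).add (hlim y)) fun m => ?_
      -- The sum of the truncations of `x` and `y` at `m • z` lies below the truncation of `x + y`
      -- at `2m • z`.
      refine le_trans ?_ (le_ciSup (hbdd (x + y)) (2 * m))
      rw [← map_add]
      refine hF.mono (le_inf (add_le_add inf_le_left inf_le_left) ?_)
      push_cast
      rw [mul_smul, two_smul]
      exact add_le_add inf_le_right inf_le_right
  · intro x hx
    have h0 : 0 ≤ ⨆ m : ℕ, F (x ⊓ (m : ℝ) • z) :=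
      ge_of_tendsto' (hlim x) fun m => hF _ (le_inf hx (hmz m))
    rw [abs_of_nonneg h0]
    refine le_of_tendsto' (hlim x) fun m => ?_
    exact (hF.mono inf_le_left).trans ((le_abs_self _).trans (F.le_opNorm x))

/-- The truncations of `x` at multiples of different `z n` are disjoint and below `x`, so their sum
is below `x`; apply `F` and let the multiples grow. -/
theorem exists_components {F : StrongDual ℝ E} (hF : IsPositiveMap F) {z : ℕ → E}
    (hz : ∀ n, 0 ≤ z n) (hd : DisjointSeq z) :
    ∃ f : ℕ → StrongDual ℝ E, (∀ n, IsPositiveMap (f n)) ∧ (∀ n, f n (z n) = F (z n)) ∧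
      ∀ (s : Finset ℕ) (x : E), 0 ≤ x → ∑ n ∈ s, f n x ≤ F x := by
  choose f hf using fun n => exists_component hF (hz n)
  have hmz : ∀ (m n : ℕ), 0 ≤ (m : ℝ) • z n := fun m n => smul_nonneg m.cast_nonneg (hz n)
  refine ⟨f, fun n x hx => ge_of_tendsto' (hf n x hx) fun m => hF _ (le_inf hx (hmz m n)),
    fun n => ?_, fun s x hx => ?_⟩
  · refine tendsto_nhds_unique (hf n _ (hz n)) (tendsto_const_nhds.congr' ?_)
    filter_upwards [eventually_ge_atTop 1] with m hm
    rw [inf_of_le_left]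
    exact le_smul_of_one_le_left (hz n) (by exact_mod_cast hm)
  · refine le_of_tendsto' (tendsto_finsetSum s fun n _ => hf n x hx) fun m => ?_
    rw [← map_sum]
    refine hF.mono (sum_le_of_disjoint s hx (fun n => le_inf hx (hmz m n)) (fun i j hij => ?_)
      fun n => inf_le_left)
    refine inf_eq_zero_mono (le_inf hx (hmz m i)) (le_inf hx (hmz m j)) inf_le_right inf_le_right
      (smul_inf_smul_eq_zero (hz i) (hz j) ?_ m.cast_nonneg m.cast_nonneg)
    have := hd i j hij
    rwa [abs_of_nonneg (hz i), abs_of_nonneg (hz j)] at this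

theorem posPart_add_le (x y : E) : (x + y)⁺ ≤ x⁺ + y⁺ :=
  sup_le (add_le_add (le_posPart x) (le_posPart y))
    (add_nonneg (posPart_nonneg x) (posPart_nonneg y))

theorem posPart_smul_of_nonneg {c : ℝ} (hc : 0 ≤ c) (x : E) : (c • x)⁺ = c • x⁺ := by
  rcases hc.eq_or_lt with rfl | hc
  · simp
  · have := (OrderIso.smulRight hc : E ≃o E).map_sup x 0
    simp only [OrderIso.smulRight_apply, smul_zero] at this
    exact this.symm

/-- Separation of a convex set from the negative cone by a positive functional. -/
theorem exists_positive_one_le {K : Set E} (hK : Convex ℝ K) {c : ℝ} (hc : 0 < c)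
    (h : ∀ k ∈ K, c ≤ ‖k⁺‖) : ∃ F : StrongDual ℝ E, IsPositiveMap F ∧ ∀ k ∈ K, 1 ≤ F k := by
  have hUo : IsOpen {x : E | ‖x⁺‖ < c} :=
    isOpen_lt continuous_posPart.norm continuous_const
  have hUc : Convex ℝ {x : E | ‖x⁺‖ < c} := by
    intro x hx y hy a b ha hb hab
    have h1 : ‖(a • x + b • y)⁺‖ ≤ a * ‖x⁺‖ + b * ‖y⁺‖ := by
      refine (norm_le_norm_of_nonneg_of_le (posPart_nonneg _) (posPart_add_le _ _)).trans ?_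
      rw [posPart_smul_of_nonneg ha, posPart_smul_of_nonneg hb]
      refine (norm_add_le _ _).trans_eq ?_
      rw [norm_smul, norm_smul, Real.norm_of_nonneg ha, Real.norm_of_nonneg hb]
    exact h1.trans_lt (convex_Iio c (𝕜 := ℝ) (Set.mem_Iio.2 hx) (Set.mem_Iio.2 hy) ha hb hab)
  obtain ⟨F, u, hFU, hFK⟩ := geometric_hahn_banach_open hUc hUo hK
    (Set.disjoint_left.2 fun x hx hxK => not_lt.2 (h x hxK) hx)
  have hu : 0 < u := by
    have := hFU 0 (by simpa using hc)
    rwa [map_zero] at this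
  have hpos : ∀ x, 0 ≤ x → 0 ≤ F x := by
    intro x hx
    by_contra! hneg
    -- The open set contains the negative cone. If `F x < 0`, this multiple of `x` lies in that cone
    -- while `F` takes the forbidden value `u` there.
    have hmem : (u / F x) • x ∈ {x : E | ‖x⁺‖ < c} := by
      have : (u / F x) • x ≤ 0 := smul_nonpos_of_nonpos_of_nonneg
        (div_nonpos_of_nonneg_of_nonpos hu.le hneg.le) hx
      simpa [posPart_of_nonpos this] using hc
    have := hFU _ hmem
    rw [map_smul, smul_eq_mul, div_mul_cancel₀ _ hneg.ne] at this
    exact lt_irrefl _ this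
  refine ⟨u⁻¹ • F, fun x hx => mul_nonneg (inv_nonneg.2 hu.le) (hpos x hx), fun k hk => ?_⟩
  change 1 ≤ u⁻¹ * F k
  rw [inv_mul_eq_div, one_le_div hu]
  exact hFK k hk

theorem exists_positive_ne_zero {x : E} (hx : 0 ≤ x) (h0 : x ≠ 0) :
    ∃ F : StrongDual ℝ E, IsPositiveMap F ∧ F x ≠ 0 := by
  obtain ⟨F, hF, h⟩ := exists_positive_one_le (convex_singleton x) (norm_pos_iff.2 h0)
    (fun k hk => by rw [Set.mem_singleton_iff.1 hk, posPart_of_nonneg hx])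
  exact ⟨F, hF, (zero_lt_one.trans_le (h x rfl)).ne'⟩

/-- Lower `ℓ¹`-estimate. -/
def LowerL1 (c : ℝ) (x : ℕ → E) : Prop :=
  ∀ (N : ℕ) (a : ℕ → ℝ), c * ∑ n ∈ Finset.range N, |a n| ≤ ‖∑ n ∈ Finset.range N, a n • x n‖

/-- Convex combinations of the `z n` are positive and, by the `ℓ¹`-estimate, have norm at least `c`;
hence their convex hull can be separated from the negative cone. -/
theorem LowerL1.exists_positive {z : ℕ → E} {c : ℝ} (h : LowerL1 c z) (hc : 0 < c)
    (hz : ∀ n, 0 ≤ z n) : ∃ F : StrongDual ℝ E, IsPositiveMap F ∧ ∀ n, 1 ≤ F (z n) := by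
  have hA : Convex ℝ {a : ℕ →₀ ℝ | (∀ n, 0 ≤ a n) ∧
      Finsupp.linearCombination ℝ (fun _ : ℕ => (1 : ℝ)) a = 1} := by
    rintro a ⟨ha, ha'⟩ b ⟨hb, hb'⟩ s t hs ht hst
    refine ⟨fun n => ?_, ?_⟩
    · exact add_nonneg (mul_nonneg hs (ha n)) (mul_nonneg ht (hb n))
    · rw [map_add, map_smul, map_smul, ha', hb', smul_eq_mul, smul_eq_mul, mul_one, mul_one, hst]
  have hK : ∀ k ∈ Finsupp.linearCombination ℝ z '' {a : ℕ →₀ ℝ | (∀ n, 0 ≤ a n) ∧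
      Finsupp.linearCombination ℝ (fun _ : ℕ => (1 : ℝ)) a = 1}, c ≤ ‖k⁺‖ := by
    rintro _ ⟨a, ⟨ha, ha1⟩, rfl⟩
    have hs : a.support ⊆ Finset.range (a.support.sup id + 1) := fun n hn =>
      Finset.mem_range.2 (Nat.lt_succ_of_le (Finset.le_sup (f := id) hn))
    have e1 := Finsupp.linearCombination_apply_of_mem_supported (v := z) ℝ
      ((Finsupp.mem_supported ℝ a).2 (Finset.coe_subset.2 hs))
    have e2 := Finsupp.linearCombination_apply_of_mem_supported (v := fun _ : ℕ => (1 : ℝ)) ℝ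
      ((Finsupp.mem_supported ℝ a).2 (Finset.coe_subset.2 hs))
    rw [e1]
    rw [posPart_of_nonneg (Finset.sum_nonneg fun n _ => smul_nonneg (ha n) (hz n))]
    have := h (a.support.sup id + 1) a
    rw [ha1] at e2
    simp only [smul_eq_mul, mul_one] at e2
    simp_rw [abs_of_nonneg (ha _)] at this
    rwa [← e2, mul_one] at this
  obtain ⟨F, hF, h1⟩ := exists_positive_one_le
    (hA.is_linear_image (Finsupp.linearCombination ℝ z).isLinear) hc hK
  refine ⟨F, hF, fun n => ?_⟩
  have := h1 _ ⟨Finsupp.single n 1, ⟨fun m => ?_, by simp⟩, rfl⟩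
  · simpa using this
  · rw [Finsupp.single_apply]
    split_ifs <;> norm_num

theorem LowerL1.of_positive {d : ℕ → E} (hd : DisjointSeq d) (hd0 : ∀ n, 0 ≤ d n)
    {F : StrongDual ℝ E} (hF : IsPositiveMap F) {δ : ℝ} (hδ : 0 < δ) (h : ∀ n, δ ≤ F (d n)) :
    0 < ‖F‖ ∧ LowerL1 (δ / ‖F‖) d := by
  have hF0 : 0 < ‖F‖ := by
    rw [norm_pos_iff]
    rintro rfl
    exact absurd (h 0) (by simpa using hδ)
  refine ⟨hF0, fun N a => ?_⟩
  rw [div_mul_eq_mul_div, div_le_iff₀ hF0]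
  have h1 : F |∑ n ∈ Finset.range N, a n • d n| = ∑ n ∈ Finset.range N, |a n| * F (d n) := by
    rw [hd.abs_sum_smul, map_sum]
    simp_rw [abs_of_nonneg (hd0 _), map_smul, smul_eq_mul]
  have h2 : δ * ∑ n ∈ Finset.range N, |a n| ≤ F |∑ n ∈ Finset.range N, a n • d n| := by
    rw [h1, Finset.mul_sum]
    refine Finset.sum_le_sum fun n _ => ?_
    rw [mul_comm]
    exact mul_le_mul_of_nonneg_left (h n) (abs_nonneg _)
  have h3 := (le_abs_self _).trans (F.le_opNorm |∑ n ∈ Finset.range N, a n • d n|)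
  rw [norm_abs_eq_norm] at h3
  linarith

end Functionals

/-! ### Consequences of order continuity of the norm -/

section OrderContinuity

variable {E : Type*} [NormedAddCommGroup E] [NormedSpace ℝ E] [Lattice E]
  [IsOrderedAddMonoid E] [IsOrderedModule ℝ E] [HasSolidNorm E]

theorem nonpos_of_forall_nsmul_le {x y : E} (h : ∀ k : ℕ, k • x⁺ ≤ y) : x ≤ 0 := by
  have hb : ∀ k : ℕ, (k : ℝ) * ‖x⁺‖ ≤ ‖y‖ := fun k => by
    have := norm_le_norm_of_nonneg_of_le (nsmul_nonneg (posPart_nonneg x) k) (h k)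
    rwa [← Nat.cast_smul_eq_nsmul ℝ, norm_smul, Real.norm_of_nonneg k.cast_nonneg] at this
  have h0 : ‖x⁺‖ = 0 := by
    by_contra hne
    have hpos : 0 < ‖x⁺‖ := lt_of_le_of_ne (norm_nonneg _) (Ne.symm hne)
    obtain ⟨k, hk⟩ := exists_nat_gt (‖y‖ / ‖x⁺‖)
    rw [div_lt_iff₀ hpos] at hk
    exact absurd (hb k) (not_le.2 hk)
  exact posPart_eq_zero.1 (norm_eq_zero.1 h0)

/-- In an order continuous norm, an upward directed order bounded set comes arbitrarily close to
its upper bounds. -/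
theorem OrderContinuousNorm.exists_upperBound_norm_sub_lt (hoc : OrderContinuousNorm E)
    {A : Set E} (hA : A.Nonempty) (hsup : ∀ a ∈ A, ∀ b ∈ A, a ⊔ b ∈ A) (hb : BddAbove A)
    {ε : ℝ} (hε : 0 < ε) : ∃ d ∈ upperBounds A, ∃ a ∈ A, ‖d - a‖ < ε := by
  suffices H : ∃ x ∈ {x | ∃ d ∈ upperBounds A, ∃ a ∈ A, d - a = x}, ‖x‖ < ε by
    obtain ⟨x, ⟨d, hd, a, ha, rfl⟩, hx⟩ := H
    exact ⟨d, hd, a, ha, hx⟩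
  refine hoc _ ?_ ?_ ⟨?_, ?_⟩ ε hε
  · obtain ⟨a, ha⟩ := hA
    obtain ⟨d, hd⟩ := hb
    exact ⟨d - a, d, hd, a, ha, rfl⟩
  · rintro _ ⟨d, hd, a, ha, rfl⟩ _ ⟨d', hd', a', ha', rfl⟩
    exact ⟨d ⊓ d' - a ⊔ a', ⟨d ⊓ d', fun b hb => le_inf (hd hb) (hd' hb), a ⊔ a',
      hsup a ha a' ha', rfl⟩, sub_le_sub inf_le_left le_sup_left,
      sub_le_sub inf_le_right le_sup_right⟩
  · rintro _ ⟨d, hd, a, ha, rfl⟩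
    exact sub_nonneg.2 (hd ha)
  · intro g hg
    -- A lower bound `g` of the gaps can be subtracted from upper bounds repeatedly, so all
    -- multiples of `g⁺` stay below one fixed gap.
    have step : ∀ d ∈ upperBounds A, d - g⁺ ∈ upperBounds A := fun d hd a ha => by
      have : g⁺ ≤ d - a := sup_le (hg ⟨d, hd, a, ha, rfl⟩) (sub_nonneg.2 (hd ha))
      rw [le_sub_comm]
      exact this
    obtain ⟨a, ha⟩ := hA
    obtain ⟨d, hd⟩ := hb
    have hk : ∀ k : ℕ, d - k • g⁺ ∈ upperBounds A := fun k => by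
      induction k with
      | zero => simpa using hd
      | succ k ih =>
        rw [succ_nsmul, ← sub_sub]
        exact step _ ih
    refine nonpos_of_forall_nsmul_le (y := d - a) fun k => ?_
    rw [le_sub_comm]
    exact hk k ha

/-- An order continuous norm yields, on each order interval, a strictly positive functional. -/
theorem OrderContinuousNorm.exists_strictlyPositive (hoc : OrderContinuousNorm E) {u : E}
    (hu : 0 ≤ u) : ∃ F : StrongDual ℝ E, IsPositiveMap F ∧
      ∀ x, 0 ≤ x → x ≤ u → F x = 0 → x = 0 := by
  let N : StrongDual ℝ E → Set E := fun F => {x | 0 ≤ x ∧ x ≤ u ∧ F x = 0}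
  have hN0 : ∀ F, (0 : E) ∈ N F := fun F => ⟨le_rfl, hu, map_zero F⟩
  have hsmall : ∀ n : ℕ, ∃ F : StrongDual ℝ E, IsPositiveMap F ∧ ∃ d ∈ upperBounds (N F),
      ‖d‖ < 1 / ((n : ℝ) + 1) := by
    intro n
    -- Adding functionals shrinks null sets, so these upper bounds are directed downward. Their
    -- infimum is zero: some `F` would detect a nonzero `g⁺` below all of them, yet `N F`, on which
    -- `F` vanishes, comes arbitrarily close to its upper bounds.
    suffices H : ∃ d ∈ {d | ∃ F : StrongDual ℝ E, IsPositiveMap F ∧ d ∈ upperBounds (N F)},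
        ‖d‖ < 1 / ((n : ℝ) + 1) by
      obtain ⟨d, ⟨F, hF, hd⟩, hlt⟩ := H
      exact ⟨F, hF, d, hd, hlt⟩
    refine hoc _ ?_ ?_ ⟨?_, ?_⟩ _ (by positivity)
    · exact ⟨u, 0, fun _ _ => le_rfl, fun x hx => hx.2.1⟩
    · rintro d ⟨F, hF, hd⟩ d' ⟨F', hF', hd'⟩
      refine ⟨d ⊓ d', ⟨F + F', hF.add hF', fun x ⟨hx0, hxu, hx⟩ => ?_⟩, inf_le_left, inf_le_right⟩
      have h1 := hF x hx0
      have h2 := hF' x hx0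
      have h3 : F x + F' x = 0 := hx
      exact le_inf (hd ⟨hx0, hxu, by linarith⟩) (hd' ⟨hx0, hxu, by linarith⟩)
    · rintro d ⟨F, hF, hd⟩
      exact hd (hN0 F)
    · intro g hg
      have hgp : ∀ F : StrongDual ℝ E, IsPositiveMap F → ∀ d ∈ upperBounds (N F), g⁺ ≤ d :=
        fun F hF d hd => sup_le (hg ⟨F, hF, hd⟩) (hd (hN0 F))
      by_contra hne
      have hg0 : g⁺ ≠ 0 := fun h => hne (posPart_eq_zero.1 h)
      obtain ⟨F, hF, hFg⟩ := exists_positive_ne_zero (posPart_nonneg g) hg0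
      refine hFg (le_antisymm (le_of_forall_pos_le_add fun ε hε => ?_) (hF _ (posPart_nonneg g)))
      have hsup : ∀ a ∈ N F, ∀ b ∈ N F, a ⊔ b ∈ N F := fun a ha b hb => by
        refine ⟨ha.1.trans le_sup_left, sup_le ha.2.1 hb.2.1,
          le_antisymm ?_ (hF _ (ha.1.trans le_sup_left))⟩
        have h1 : a ⊔ b ≤ a + b :=
          sup_le (le_add_of_nonneg_right hb.1) (le_add_of_nonneg_left ha.1)
        have h2 := hF.mono h1
        rwa [map_add, ha.2.2, hb.2.2, add_zero] at h2
      obtain ⟨d, hd, a, ha, hda⟩ := hoc.exists_upperBound_norm_sub_lt (A := N F) ⟨0, hN0 F⟩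
        hsup ⟨u, fun x hx => hx.2.1⟩ (ε := ε / (‖F‖ + 1)) (by positivity)
      have h1 := hF.mono (hgp F hF d hd)
      have h2 : F d = F (d - a) := by rw [map_sub, ha.2.2, sub_zero]
      have h3 := (le_abs_self _).trans (F.le_opNorm (d - a))
      rw [lt_div_iff₀ (by positivity)] at hda
      nlinarith [norm_nonneg (d - a)]
  choose F hF d hd hlt using hsmall
  have hw : ∀ n, 0 < (1 / 2 : ℝ) ^ n / (‖F n‖ + 1) := fun n => by positivity
  -- A zero of this weighted sum in `[0, u]` is a zero of every `F n`, hence lies below every `d n`.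
  have hsum : Summable fun n => ((1 / 2 : ℝ) ^ n / (‖F n‖ + 1)) • F n := by
    refine Summable.of_norm_bounded summable_geometric_two fun n => ?_
    rw [norm_smul, Real.norm_of_nonneg (hw n).le, div_mul_eq_mul_div]
    refine div_le_of_le_mul₀ (by positivity) (by positivity) ?_
    exact mul_le_mul_of_nonneg_left (by linarith) (by positivity)
  have hval : ∀ x, HasSum (fun n => ((1 / 2 : ℝ) ^ n / (‖F n‖ + 1)) * F n x)
      ((∑' n, ((1 / 2 : ℝ) ^ n / (‖F n‖ + 1)) • F n) x) := fun x =>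
    hsum.hasSum.mapL (ContinuousLinearMap.apply ℝ ℝ x)
  refine ⟨∑' n, ((1 / 2 : ℝ) ^ n / (‖F n‖ + 1)) • F n, fun x hx => ?_, fun x hx hxu h0 => ?_⟩
  · exact (hval x).nonneg fun n => mul_nonneg (hw n).le (hF n x hx)
  · have hz := (hasSum_zero_iff_of_nonneg fun n => mul_nonneg (hw n).le (hF n x hx)).1
      (h0 ▸ hval x)
    have hx0 : ∀ n : ℕ, ‖x‖ ≤ 1 / ((n : ℝ) + 1) := fun n => by
      have h1 : F n x = 0 := (mul_eq_zero.1 (congrFun hz n)).resolve_left (hw n).ne'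
      exact (norm_le_norm_of_nonneg_of_le hx (hd n ⟨hx, hxu, h1⟩)).trans (hlt n).le
    have := ge_of_tendsto' tendsto_one_div_add_atTop_nhds_zero_nat hx0
    exact norm_le_zero_iff.1 this

/-- Positive weakly null sequences converge to zero in norm on order intervals. -/
theorem OrderContinuousNorm.tendsto_norm_inf (hoc : OrderContinuousNorm E) {y : ℕ → E}
    (hy : ∀ n, 0 ≤ y n)
    (hw : ∀ F : StrongDual ℝ E, IsPositiveMap F → Tendsto (fun n => F (y n)) atTop (𝓝 0))
    {u : E} (hu : 0 ≤ u) : Tendsto (fun n => ‖y n ⊓ u‖) atTop (𝓝 0) := by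
  obtain ⟨F, hF, hstrict⟩ := hoc.exists_strictlyPositive hu
  by_contra hcon
  rw [Metric.tendsto_atTop] at hcon
  push Not at hcon
  obtain ⟨ε, hε, hbig⟩ := hcon
  have hch : ∀ k : ℕ, ∃ n, ε ≤ ‖y n ⊓ u‖ ∧ F (y n) ≤ (1 / 2) ^ k := fun k => by
    obtain ⟨N, hN⟩ := ((hw F hF).eventually (ge_mem_nhds
      (show (0 : ℝ) < (1 / 2) ^ k by positivity))).exists_forall_of_atTop
    obtain ⟨n, hn, h⟩ := hbig N
    rw [Real.dist_0_eq_abs, abs_norm] at h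
    exact ⟨n, h, hN n hn⟩
  choose i hi1 hi2 using hch
  let v : ℕ → E := fun k => y (i k) ⊓ u
  have hv0 : ∀ k, 0 ≤ v k := fun k => le_inf (hy _) hu
  have hvu : ∀ k, v k ≤ u := fun k => inf_le_right
  have hFv : ∀ k, F (v k) ≤ (1 / 2) ^ k := fun k => (hF.mono inf_le_left).trans (hi2 k)
  -- Order continuity is applied to the eventual upper bounds of `v`. Their infimum is zero because
  -- the values `F (v k)` are summable and `F` is strictly positive on `[0, u]`.
  suffices H : ∃ d ∈ {d | ∃ m, ∀ k, m ≤ k → v k ≤ d}, ‖d‖ < ε by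
    obtain ⟨d, ⟨m, hm⟩, hd⟩ := H
    exact absurd hd (not_lt.2 ((hi1 m).trans (norm_le_norm_of_nonneg_of_le (hv0 m)
      (hm m le_rfl))))
  refine hoc _ ⟨u, (⟨0, fun k _ => hvu k⟩ : ∃ m, ∀ k, m ≤ k → v k ≤ u)⟩ ?_ ⟨?_, ?_⟩ ε hε
  · rintro d ⟨m, hm⟩ d' ⟨m', hm'⟩
    exact ⟨d ⊓ d', ⟨max m m', fun k hk => le_inf (hm k ((le_max_left _ _).trans hk))
      (hm' k ((le_max_right _ _).trans hk))⟩, inf_le_left, inf_le_right⟩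
  · rintro d ⟨m, hm⟩
    exact (hv0 m).trans (hm m le_rfl)
  · intro g hg
    have hgp : ∀ d m, (∀ k, m ≤ k → v k ≤ d) → g⁺ ≤ d := fun d m hd =>
      sup_le (hg ⟨m, hd⟩) ((hv0 m).trans (hd m le_rfl))
    refine posPart_eq_zero.1 (hstrict _ (posPart_nonneg g) (hgp u 0 fun k _ => hvu k) ?_)
    refine le_antisymm ?_ (hF _ (posPart_nonneg g))
    -- Elements of `[0, u]`-type bound lying below partial sums of the tail stand in for its
    -- supremum. The geometric tail contributes 2 and the approximation error 1.
    have hest : ∀ m : ℕ, F g⁺ ≤ 3 * (1 / 2) ^ m := fun m => by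
      have hmono : Monotone fun N => ∑ k ∈ Finset.range N, v (m + k) := fun N N' h =>
        Finset.sum_le_sum_of_subset_of_nonneg (Finset.range_mono h) fun k _ _ => hv0 _
      obtain ⟨d, hd, a, ⟨-, N, haN⟩, hda⟩ := hoc.exists_upperBound_norm_sub_lt
        (A := {a | a ≤ u ∧ ∃ N, a ≤ ∑ k ∈ Finset.range N, v (m + k)}) ⟨0, hu, 0, by simp⟩
        (fun a ⟨ha, N, haN⟩ b ⟨hb, N', hbN⟩ => ⟨sup_le ha hb, max N N',
          sup_le (haN.trans (hmono (le_max_left _ _))) (hbN.trans (hmono (le_max_right _ _)))⟩)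
        ⟨u, fun a ha => ha.1⟩ (ε := (1 / 2) ^ m / (‖F‖ + 1)) (by positivity)
      have h1 : g⁺ ≤ d := hgp d m fun k hk => hd ⟨hvu k, k - m + 1, by
        have := Finset.single_le_sum (f := fun j => v (m + j)) (fun j _ => hv0 _)
          (Finset.mem_range.2 (Nat.lt_succ_self (k - m)))
        simpa [Nat.add_sub_cancel' hk] using this⟩
      have h2 := hF.mono h1
      have h3 : F d = F (d - a) + F a := by rw [map_sub, sub_add_cancel]
      have h4 := (le_abs_self _).trans (F.le_opNorm (d - a))
      have h5 : F a ≤ 2 * (1 / 2) ^ m := by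
        refine (hF.mono haN).trans ?_
        rw [map_sum]
        refine (Finset.sum_le_sum fun k _ => hFv (m + k)).trans ?_
        simp_rw [pow_add]
        rw [← Finset.mul_sum, mul_comm]
        refine mul_le_mul_of_nonneg_right ?_ (by positivity)
        exact (summable_geometric_two.sum_le_tsum _ fun k _ => by positivity).trans_eq
          tsum_geometric_two
      rw [lt_div_iff₀ (by positivity)] at hda
      nlinarith [norm_nonneg (d - a)]
    have hlim : Tendsto (fun m : ℕ => 3 * (1 / 2 : ℝ) ^ m) atTop (𝓝 0) := by
      have := (tendsto_pow_atTop_nhds_zero_of_lt_one (r := (1 / 2 : ℝ)) (by norm_num)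
        (by norm_num)).const_mul 3
      simpa using this
    exact ge_of_tendsto' hlim hest

end OrderContinuity

/-! ### Order continuity of the dual norm and disjoint sequences -/

section Dual

variable {E : Type*} [NormedAddCommGroup E] [NormedSpace ℝ E] [Lattice E]
  [IsOrderedAddMonoid E] [IsOrderedModule ℝ E] [HasSolidNorm E]

/-- Otherwise the components of `F` on a subsequence have tail sums `H N` decreasing to zero in the
dual, hence in norm, although `H N` stays at least `ε` on the `N`-th vector of that bounded
subsequence. -/
theorem DualOrderContinuous.tendsto_of_disjoint (hdual : DualOrderContinuous E)
    {F : StrongDual ℝ E} (hF : IsPositiveMap F) {d : ℕ → E} (hd : DisjointSeq d)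
    (hd0 : ∀ n, 0 ≤ d n) {C : ℝ} (hC : ∀ n, ‖d n‖ ≤ C) :
    Tendsto (fun n => F (d n)) atTop (𝓝 0) := by
  by_contra hcon
  rw [Metric.tendsto_atTop] at hcon
  push Not at hcon
  obtain ⟨ε, hε, hbig⟩ := hcon
  have hfr : ∃ᶠ n in atTop, ε ≤ F (d n) := frequently_atTop.2 fun N => by
    obtain ⟨n, hn, h⟩ := hbig N
    rw [Real.dist_0_eq_abs, abs_of_nonneg (hF _ (hd0 n))] at h
    exact ⟨n, hn, h⟩
  obtain ⟨φ, hφ, hFφ⟩ := extraction_of_frequently_atTop hfr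
  obtain ⟨f, hf0, hfz, hfs⟩ := exists_components hF (z := d ∘ φ) (fun n => hd0 _)
    (hd.comp hφ.injective)
  have hsum : ∀ x, 0 ≤ x → Summable fun n => f n x := fun x hx =>
    summable_of_sum_le (fun n => hf0 n x hx) fun s => hfs s x hx
  have hsumN : ∀ x, 0 ≤ x → ∀ N, Summable fun n => f (n + N) x := fun x hx N =>
    (summable_nat_add_iff N).2 (hsum x hx)
  have hH : ∀ N : ℕ, ∃ H : StrongDual ℝ E, ∀ x, 0 ≤ x → H x = ∑' n, f (n + N) x := fun N => by
    refine exists_strongDual_of_additive (M := ‖F‖) (fun x y hx hy => ?_) fun x hx => ?_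
    · simp_rw [map_add]
      exact (hsumN x hx N).tsum_add (hsumN y hy N)
    · rw [abs_of_nonneg (tsum_nonneg fun n => hf0 _ x hx)]
      refine (Real.tsum_le_of_sum_range_le (fun n => hf0 _ x hx) (c := F x) fun n => ?_).trans
        ((le_abs_self _).trans (F.le_opNorm x))
      refine le_trans ?_ (hfs ((Finset.range n).map (addRightEmbedding N)) x hx)
      rw [Finset.sum_map]
      rfl
  choose H hH using hH
  have hHstep : ∀ N x, 0 ≤ x → H N x = f N x + H (N + 1) x := fun N x hx => by
    rw [hH N x hx, hH (N + 1) x hx, (hsumN x hx N).tsum_eq_zero_add, zero_add]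
    congr 2
    funext n
    rw [add_right_comm, add_assoc]
  have hHanti : ∀ x, 0 ≤ x → Antitone fun N => H N x := fun x hx =>
    antitone_nat_of_succ_le fun N => by
      rw [hHstep N x hx]
      exact le_add_of_nonneg_left (hf0 N x hx)
  have hHlim : ∀ x, 0 ≤ x → Tendsto (fun N => H N x) atTop (𝓝 0) := fun x hx => by
    simp_rw [hH _ x hx]
    exact tendsto_sum_nat_add fun n => f n x
  have hH0 : ∀ N x, 0 ≤ x → 0 ≤ H N x := fun N x hx => by
    rw [hH N x hx]
    exact tsum_nonneg fun n => hf0 _ x hx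
  have hCpos : 0 < |C| + 1 := by positivity
  have key : ∃ N, ‖H N‖ < ε / (|C| + 1) := by
    obtain ⟨_, ⟨N, rfl⟩, h⟩ := hdual (Set.range H) ⟨_, 0, rfl⟩ (by
      rintro _ ⟨N, rfl⟩ _ ⟨N', rfl⟩
      exact ⟨_, ⟨max N N', rfl⟩, fun x hx => hHanti x hx (le_max_left _ _),
        fun x hx => hHanti x hx (le_max_right _ _)⟩) (by
      refine ⟨?_, fun g hg x hx => ?_⟩
      · rintro _ ⟨N, rfl⟩ x hx
        exact hH0 N x hx
      · exact ge_of_tendsto' (hHlim x hx) fun N => hg ⟨N, rfl⟩ x hx) (ε / (|C| + 1))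
      (by positivity)
    exact ⟨N, h⟩
  obtain ⟨N, hN⟩ := key
  have h1 : ε ≤ H N (d (φ N)) := by
    rw [hHstep N _ (hd0 _)]
    have := hfz N
    have h2 := hFφ N
    have h3 := hH0 (N + 1) _ (hd0 (φ N))
    simp only [Function.comp] at this
    linarith
  have h2 := h1.trans ((le_abs_self _).trans ((H N).le_opNorm (d (φ N))))
  have h3 := (hC (φ N)).trans (le_abs_self C)
  rw [lt_div_iff₀ hCpos] at hN
  nlinarith [norm_nonneg (H N), norm_nonneg (d (φ N))]

/-- Selection of a sequence, each term depending on a majorant of the previous ones, followed by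
its disjointification. -/
theorem exists_disjointSeq_of_choice [CompleteSpace E] {ι : Type*} {x : ι → E} {C ε : ℝ}
    (hx : ∀ i, 0 ≤ x i) (hC : ∀ i, ‖x i‖ ≤ C) (hε : 0 < ε) {Q : List ι → E → ι → Prop}
    (h : ∀ l u, 0 ≤ u → ∃ i, Q l u i) :
    ∃ (i : ℕ → ι) (u r : ℕ → E), (∀ k, 0 ≤ u k) ∧ (∀ k, 0 ≤ r k) ∧
      (∀ k, ‖r k‖ ≤ C * ε * (1 / 2) ^ k) ∧ (∀ k, Q ((List.range k).map i) (u k) (i k)) ∧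
      DisjointSeq fun k => (x (i k) - u k - r k)⁺ := by
  obtain ⟨i, hi⟩ := exists_seq_of_forall_list
    (Q := fun l i => Q l ((ε⁻¹ * 2 ^ l.length) • (l.map x).sum) i) fun l =>
      h l _ (smul_nonneg (by positivity) (List.sum_nonneg fun y hy => by
        obtain ⟨j, -, rfl⟩ := List.mem_map.1 hy
        exact hx j))
  obtain ⟨r, hr0, hr, hdis⟩ := exists_disjointSeq_posPart (x := fun k => x (i k))
    (fun k => hx _) (fun k => hC _) hε
  refine ⟨i, fun k => (ε⁻¹ * 2 ^ k) • ∑ j ∈ Finset.range k, x (i j), r, fun k =>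
    smul_nonneg (by positivity) (Finset.sum_nonneg fun j _ => hx _), hr0, hr, fun k => ?_, hdis⟩
  have := hi k
  rw [List.length_map, List.length_range, List.map_map] at this
  exact this

theorem IsPositiveMap.exists_norm_le_one {G : StrongDual ℝ E} (hG : IsPositiveMap G) {c : ℝ}
    (hc : 0 ≤ c) (h : c < ‖G‖) : ∃ x, 0 ≤ x ∧ ‖x‖ ≤ 1 ∧ c < G x := by
  by_contra! hcon
  refine absurd (G.opNorm_le_bound hc fun x => ?_) (not_le.2 h)
  rcases eq_or_ne x 0 with rfl | hx
  · simp
  · have hn : 0 < ‖x‖ := norm_pos_iff.2 hx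
    have h1 := hcon (‖x‖⁻¹ • |x|) (smul_nonneg (inv_nonneg.2 hn.le) (abs_nonneg x)) (by
      rw [norm_smul, norm_abs_eq_norm, norm_inv, norm_norm, inv_mul_cancel₀ hn.ne'])
    rw [map_smul, smul_eq_mul, inv_mul_le_iff₀ hn] at h1
    have h2 := hG.abs_le x
    rw [Real.norm_eq_abs]
    linarith

/-- A directed family with infimum zero and norms at least `ε` contains members tiny at any
prescribed majorant of earlier vectors, yet large at some positive unit-ball vector. Disjointifying
these vectors costs little, and one member `G₀` dominates all the functionals used. -/
theorem exists_disjoint_of_not_dualOrderContinuous [CompleteSpace E]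
    (h : ¬ DualOrderContinuous E) :
    ∃ (d : ℕ → E) (F : StrongDual ℝ E) (δ : ℝ), DisjointSeq d ∧ (∀ n, 0 ≤ d n) ∧
      (∀ n, ‖d n‖ ≤ 1) ∧ IsPositiveMap F ∧ 0 < δ ∧ ∀ n, δ ≤ F (d n) := by
  obtain ⟨D, ⟨G₀, hG₀⟩, hdir, hglb0, hglb, ε, hε, hbig⟩ : ∃ D : Set (StrongDual ℝ E),
      D.Nonempty ∧
      (∀ G ∈ D, ∀ G' ∈ D, ∃ K ∈ D, (∀ x, 0 ≤ x → K x ≤ G x) ∧ ∀ x, 0 ≤ x → K x ≤ G' x) ∧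
      (∀ G ∈ D, IsPositiveMap G) ∧
      (∀ g : StrongDual ℝ E, (∀ G ∈ D, ∀ x, 0 ≤ x → g x ≤ G x) → ∀ x, 0 ≤ x → g x ≤ 0) ∧
      ∃ ε > 0, ∀ G ∈ D, ε ≤ ‖G‖ := by
    unfold DualOrderContinuous OrderContinuousNorm at h
    push Not at h
    obtain ⟨D, hne, hdir, hglb, ε, hε, hbig⟩ := h
    exact ⟨D, hne, hdir, fun G hG x hx => hglb.1 hG x hx,
      fun g hg x hx => hglb.2 (fun G hG => hg G hG) x hx, ε, hε, hbig⟩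
  have : Nonempty D := ⟨⟨G₀, hG₀⟩⟩
  have hbdd : ∀ x, 0 ≤ x → BddBelow (Set.range fun G : D => (G : StrongDual ℝ E) x) :=
    fun x hx => ⟨0, by rintro _ ⟨G, rfl⟩; exact hglb0 G.1 G.2 x hx⟩
  -- Directedness makes the pointwise infimum additive on the cone, so it is a functional and the
  -- order infimum is pointwise.
  obtain ⟨g, hg⟩ : ∃ g : StrongDual ℝ E, ∀ x, 0 ≤ x →
      g x = ⨅ G : D, (G : StrongDual ℝ E) x := by
    refine exists_strongDual_of_additive (M := ‖G₀‖) (fun x y hx hy => ?_) fun x hx => ?_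
    · refine le_antisymm ?_ ?_
      · refine le_ciInf_add_ciInf fun G G' => ?_
        obtain ⟨K, hK, h1, h2⟩ := hdir G G.2 G' G'.2
        refine (ciInf_le (hbdd _ (add_nonneg hx hy)) ⟨K, hK⟩).trans ?_
        change K (x + y) ≤ _
        rw [map_add]
        exact add_le_add (h1 x hx) (h2 y hy)
      · refine le_ciInf fun G => ?_
        rw [map_add]
        exact add_le_add (ciInf_le (hbdd x hx) G) (ciInf_le (hbdd y hy) G)
    · rw [abs_of_nonneg (le_ciInf fun G : D => hglb0 G.1 G.2 x hx)]
      exact (ciInf_le (hbdd x hx) ⟨G₀, hG₀⟩).trans ((le_abs_self _).trans (G₀.le_opNorm x))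
  have hsmall : ∀ x, 0 ≤ x → ∀ η > 0, ∃ G ∈ D, (∀ y, 0 ≤ y → G y ≤ G₀ y) ∧ G x < η := by
    intro x hx η hη
    have h0 := hglb g (fun G hG y hy => by rw [hg y hy]; exact ciInf_le (hbdd y hy) ⟨G, hG⟩) x hx
    rw [hg x hx] at h0
    obtain ⟨G, hG⟩ := exists_lt_of_ciInf_lt (h0.trans_lt hη)
    obtain ⟨K, hK, h1, h2⟩ := hdir G G.2 G₀ hG₀
    exact ⟨K, hK, h2, (h1 x hx).trans_lt hG⟩
  let ι := {p : StrongDual ℝ E × E // IsPositiveMap p.1 ∧ (∀ y, 0 ≤ y → p.1 y ≤ G₀ y) ∧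
    0 ≤ p.2 ∧ ‖p.2‖ ≤ 1 ∧ ε / 2 < p.1 p.2}
  have hε0 : 0 < ε / (8 * (‖G₀‖ + 1)) := by positivity
  obtain ⟨i, u, r, hu, hr0, hr, hQ, hdis⟩ := exists_disjointSeq_of_choice (ι := ι)
    (x := fun i => i.1.2) (C := 1) (fun i => i.2.2.2.1) (fun i => i.2.2.2.2.1) hε0
    (Q := fun _ u i => i.1.1 u < ε / 8) (fun _ u hu => by
      obtain ⟨G, hG, hGG, hGu⟩ := hsmall u hu (ε / 8) (by positivity)
      obtain ⟨x, hx0, hx1, hx⟩ := (hglb0 G hG).exists_norm_le_one (c := ε / 2) (by positivity)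
        (by linarith [hbig G hG])
      exact ⟨⟨(G, x), hglb0 G hG, hGG, hx0, hx1, hx⟩, hGu⟩)
  -- Of the initial `ε / 2`, the majorant `u n` and the error `r n` each cost at most `ε / 8`.
  refine ⟨_, G₀, ε / 4, hdis, fun n => posPart_nonneg _, fun n => ?_, hglb0 G₀ hG₀,
    by positivity, fun n => ?_⟩
  · refine (norm_le_norm_of_nonneg_of_le (posPart_nonneg _) ?_).trans (i n).2.2.2.2.1
    refine sup_le ?_ (i n).2.2.2.1
    rw [sub_sub]
    exact sub_le_self _ (add_nonneg (hu n) (hr0 n))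
  · obtain ⟨hpos, hle, -, -, hbig'⟩ := (i n).2
    have h1 := hle _ (posPart_nonneg ((i n).1.2 - u n - r n))
    have h2 := hpos.mono (le_posPart ((i n).1.2 - u n - r n))
    rw [map_sub, map_sub] at h2
    have h3 := hle _ (hr0 n)
    have h4 := (le_abs_self _).trans (G₀.le_opNorm (r n))
    have h5 : ‖r n‖ ≤ ε / (8 * (‖G₀‖ + 1)) := by
      refine (hr n).trans ?_
      rw [one_mul]
      exact mul_le_of_le_one_right hε0.le (pow_le_one₀ (by norm_num) (by norm_num))
    rw [le_div_iff₀ (by positivity)] at h5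
    have h6 := hQ n
    nlinarith [norm_nonneg (r n)]

end Dual

/-! ### Subsequence selection and Rosenthal's lemma -/

theorem tendsto_zero_of_subseq {f : ℕ → ℝ} (hf : ∀ n, 0 ≤ f n)
    (h : ∀ φ : ℕ → ℕ, StrictMono φ → ∀ ε > 0, ¬ ∀ n, ε ≤ f (φ n)) :
    Tendsto f atTop (𝓝 0) := by
  by_contra hcon
  rw [Metric.tendsto_atTop] at hcon
  push Not at hcon
  obtain ⟨ε, hε, hbig⟩ := hcon
  have hfr : ∃ᶠ n in atTop, ε ≤ f n := frequently_atTop.2 fun N => by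
    obtain ⟨n, hn, h⟩ := hbig N
    rw [Real.dist_0_eq_abs, abs_of_nonneg (hf n)] at h
    exact ⟨n, hn, h⟩
  obtain ⟨φ, hφ, hFφ⟩ := extraction_of_frequently_atTop hfr
  exact h φ hφ ε hε hFφ

theorem strictMono_of_forall_mem_map_range {i : ℕ → ℕ}
    (h : ∀ k, ∀ j ∈ (List.range k).map i, j < i k) : StrictMono i :=
  strictMono_nat_of_lt_succ fun n => h (n + 1) _
    (List.mem_map.2 ⟨n, List.mem_range.2 n.lt_succ_self, rfl⟩)

theorem lt_of_forall_mem_list (l : List ℕ) : ∀ᶠ n in atTop, ∀ j ∈ l, j < n := by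
  induction l with
  | nil => simp
  | cons a l ih =>
    filter_upwards [ih, eventually_gt_atTop a] with n h1 h2
    simpa using ⟨h2, h1⟩

theorem eventually_forall_mem_list {α β : Type*} {F : Filter α} {p : β → α → Prop} (l : List β)
    (h : ∀ b ∈ l, ∀ᶠ n in F, p b n) : ∀ᶠ n in F, ∀ b ∈ l, p b n := by
  induction l with
  | nil => simp
  | cons a l ih =>
    filter_upwards [ih fun b hb => h b (List.mem_cons_of_mem _ hb), h a List.mem_cons_self]
      with n h1 h2
    simpa using ⟨h2, h1⟩

/-- Rosenthal's lemma for non-negative matrices with bounded column sums. -/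
theorem exists_subseq_offDiagonal_sum_le {a : ℕ → ℕ → ℝ} {M η : ℝ} (ha : ∀ j k, 0 ≤ a j k)
    (hM : ∀ (s : Finset ℕ) (k : ℕ), ∑ j ∈ s, a j k ≤ M) (hη : 0 < η) :
    ∃ φ : ℕ → ℕ, StrictMono φ ∧
      ∀ (k : ℕ) (s : Finset ℕ), k ∉ s → ∑ j ∈ s, a (φ j) (φ k) ≤ η := by
  have hcol : ∀ k, Tendsto (fun j => a j k) atTop (𝓝 0) := fun k =>
    (summable_of_sum_le (fun j => ha j k) fun s => hM s k).tendsto_atTop_zero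
  have haM : ∀ j k, a j k ≤ M := fun j k => by simpa using hM {j} k
  -- Limits along an ultrafilter replace a diagonal extraction; the column bound passes to the row
  -- limits and makes them summable.
  have hlim : ∀ j, ∃ b, Tendsto (a j) (hyperfilter ℕ) (𝓝 b) := fun j => by
    obtain ⟨b, -, hb⟩ := (isCompact_Icc (a := (0 : ℝ)) (b := M)).ultrafilter_le_nhds
      ((hyperfilter ℕ).map (a j))
      (by
        rw [Ultrafilter.coe_map, le_principal_iff]
        exact mem_map.2 (univ_mem' fun k => ⟨ha j k, haM j k⟩))
    exact ⟨b, hb⟩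
  choose b hb using hlim
  have hb0 : ∀ j, 0 ≤ b j := fun j => ge_of_tendsto' (hb j) (ha j)
  have hbsum : Summable b := summable_of_sum_le hb0 (c := M) fun s =>
    le_of_tendsto' (tendsto_finsetSum s fun j _ => hb j) fun k => hM s k
  obtain ⟨J, hJ⟩ : ∃ J, ∀ s : Finset ℕ, (∀ j ∈ s, J ≤ j) → ∑ j ∈ s, b j ≤ η / 4 := by
    obtain ⟨t, ht⟩ := summable_iff_vanishing_norm.1 hbsum (η / 4) (by positivity)
    refine ⟨t.sup id + 1, fun s hs => ?_⟩
    refine (le_abs_self _).trans (ht s (Finset.disjoint_left.2 fun j hj hjt => ?_)).le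
    have := Finset.le_sup (f := id) hjt
    have h2 := hs j hj
    simp only [id] at this
    omega
  -- Each new index makes its row small at earlier columns and its column close to the row limits at
  -- earlier rows. Above the diagonal this costs `η / 4` for the limits and `η / 4` for the
  -- deviations; below it, a geometric sum costs `η / 2`.
  obtain ⟨φ, hφ⟩ := exists_seq_of_forall_list
    (Q := fun l n => J ≤ n ∧ (∀ j ∈ l, j < n) ∧ (∀ j ∈ l, a n j ≤ η / 4 * (1 / 2) ^ l.length) ∧
      ∀ j ∈ l, a j n ≤ b j + η / 4 / (l.length + 1)) fun l => by
    have h1 : ∀ᶠ n in (atTop : Filter ℕ), J ≤ n ∧ (∀ j ∈ l, j < n) ∧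
        ∀ j ∈ l, a n j ≤ η / 4 * (1 / 2) ^ l.length :=
      (eventually_ge_atTop J).and ((lt_of_forall_mem_list l).and
        (eventually_forall_mem_list l fun j _ => (hcol j).eventually (ge_mem_nhds
          (by positivity))))
    have h2 : ∀ᶠ n in (hyperfilter ℕ : Filter ℕ),
        ∀ j ∈ l, a j n ≤ b j + η / 4 / (l.length + 1) :=
      eventually_forall_mem_list l fun j _ => (hb j).eventually (ge_mem_nhds
        (lt_add_of_pos_right _ (by positivity)))
    have h3 : (hyperfilter ℕ : Filter ℕ) ≤ atTop := by
      rw [← Nat.cofinite_eq_atTop]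
      exact hyperfilter_le_cofinite
    obtain ⟨n, hn1, hn2⟩ := ((h1.filter_mono h3).and h2).exists
    exact ⟨n, hn1.1, hn1.2.1, hn1.2.2, hn2⟩
  simp only [List.length_map, List.length_range] at hφ
  have hmono := strictMono_of_forall_mem_map_range fun k => (hφ k).2.1
  have hmem : ∀ {j k}, j < k → φ j ∈ (List.range k).map φ := fun h =>
    List.mem_map.2 ⟨_, List.mem_range.2 h, rfl⟩
  refine ⟨φ, hmono, fun k s hk => ?_⟩
  rw [← Finset.sum_filter_add_sum_filter_not s (· < k)]
  have e1 : ∑ j ∈ s with j < k, a (φ j) (φ k) ≤ η / 4 + η / 4 := by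
    have h1 : ∀ j ∈ s.filter (· < k), a (φ j) (φ k) ≤ b (φ j) + η / 4 / (k + 1) := fun j hj =>
      (hφ k).2.2.2 _ (hmem (Finset.mem_filter.1 hj).2)
    refine (Finset.sum_le_sum h1).trans ?_
    rw [Finset.sum_add_distrib]
    refine add_le_add ?_ ?_
    · have := hJ ((s.filter (· < k)).map ⟨φ, hmono.injective⟩) fun j hj => by
        obtain ⟨i, -, rfl⟩ := Finset.mem_map.1 hj
        exact (hφ i).1
      rwa [Finset.sum_map] at this
    · rw [Finset.sum_const, nsmul_eq_mul]
      have hcard : ((s.filter (· < k)).card : ℝ) ≤ k + 1 := by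
        have : (s.filter (· < k)).card ≤ (Finset.range k).card :=
          Finset.card_le_card fun j hj => Finset.mem_range.2 (Finset.mem_filter.1 hj).2
        rw [Finset.card_range] at this
        exact_mod_cast this.trans k.le_succ
      calc ((s.filter (· < k)).card : ℝ) * (η / 4 / (k + 1))
          ≤ (k + 1) * (η / 4 / (k + 1)) := mul_le_mul_of_nonneg_right hcard (by positivity)
        _ = η / 4 := by field_simp
  have e2 : ∑ j ∈ s with ¬ j < k, a (φ j) (φ k) ≤ η / 4 * 2 := by
    have h1 : ∀ j ∈ s.filter (¬ · < k), a (φ j) (φ k) ≤ η / 4 * (1 / 2) ^ j := fun j hj => by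
      obtain ⟨hjs, hjk⟩ := Finset.mem_filter.1 hj
      have hne : j ≠ k := fun h => hk (h ▸ hjs)
      exact (hφ j).2.2.1 _ (hmem (by omega))
    refine (Finset.sum_le_sum h1).trans ?_
    rw [← Finset.mul_sum]
    refine mul_le_mul_of_nonneg_left ?_ (by positivity)
    exact (summable_geometric_two.sum_le_tsum _ fun k _ => by positivity).trans_eq
      tsum_geometric_two
  linarith

/-! ### Truncation, Kadec–Pełczyński, compactness and strict singularity criteria -/

section Tools

variable {E : Type*} [NormedAddCommGroup E] [NormedSpace ℝ E] [Lattice E]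
  [IsOrderedAddMonoid E] [IsOrderedModule ℝ E] [HasSolidNorm E]

theorem IsRegularOp.exists_dominating {R : E →L[ℝ] E} (hR : IsRegularOp R) :
    ∃ V : E →L[ℝ] E, IsPositiveMap V ∧ ∀ x, |R x| ≤ V |x| := by
  obtain ⟨P, Q, hP, hQ, rfl⟩ := hR
  have hP : IsPositiveMap P := hP
  have hQ : IsPositiveMap Q := hQ
  refine ⟨P + Q, hP.add hQ, fun x => ?_⟩
  have h1 : |(P - Q) x| ≤ |P x| + |Q x| := by
    have := abs_add_le (P x) (-Q x)
    rwa [abs_neg, ← sub_eq_add_neg] at this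
  exact h1.trans (add_le_add (hP.abs_le x) (hQ.abs_le x))

/-- Truncation of an element at a positive level. -/
theorem exists_truncation (x : E) {c : E} (hc : 0 ≤ c) :
    ∃ y, |y| ≤ c ∧ x - y = (x⁺ - c)⁺ - (x⁻ - c)⁺ := by
  refine ⟨x⁺ ⊓ c - x⁻ ⊓ c, ?_, ?_⟩
  · have hp : 0 ≤ x⁺ ⊓ c := le_inf (posPart_nonneg x) hc
    have hn : 0 ≤ x⁻ ⊓ c := le_inf (negPart_nonneg x) hc
    exact abs_le'.2 ⟨(sub_le_self _ hn).trans inf_le_right, by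
      rw [neg_sub]
      exact (sub_le_self _ hp).trans inf_le_right⟩
  · rw [← sub_inf_eq, ← sub_inf_eq]
    nth_rewrite 1 [← posPart_sub_negPart x]
    abel

theorem norm_posPart_sub_sub_le (x : E) {c : E} :
    ‖(x⁺ - c)⁺ - (x⁻ - c)⁺‖ ≤ 2 * ‖(|x| - c)⁺‖ := by
  refine (norm_sub_le _ _).trans ?_
  rw [two_mul]
  exact add_le_add
    (norm_le_norm_of_nonneg_of_le (posPart_nonneg _)
      (posPart_mono (sub_le_sub_right (posPart_le_abs x) c)))
    (norm_le_norm_of_nonneg_of_le (posPart_nonneg _)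
      (posPart_mono (sub_le_sub_right (negPart_le_abs x) c)))

/-- Kadec–Pełczyński: a bounded sequence whose truncations vanish in norm has a subsequence close
to a disjoint sequence. -/
theorem exists_subseq_near_disjoint [CompleteSpace E] {x : ℕ → E} {C : ℝ} (hC : ∀ n, ‖x n‖ ≤ C)
    (hx : ∀ u, 0 ≤ u → Tendsto (fun n => ‖|x n| ⊓ u‖) atTop (𝓝 0)) :
    ∃ (φ : ℕ → ℕ) (d : ℕ → E), StrictMono φ ∧ DisjointSeq d ∧
      ∀ k, ‖x (φ k) - d k‖ ≤ 4 * (1 / 2) ^ k := by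
  have hC0 : 0 ≤ C := (norm_nonneg _).trans (hC 0)
  obtain ⟨φ, u, r, hu, hr0, hr, hQ, hdis⟩ := exists_disjointSeq_of_choice
    (x := fun n => |x n|) (C := C) (ε := 1 / (C + 1)) (fun n => abs_nonneg _)
    (fun n => by rw [norm_abs_eq_norm]; exact hC n) (by positivity)
    (Q := fun l u n => (∀ j ∈ l, j < n) ∧ ‖|x n| ⊓ u‖ ≤ (1 / 2) ^ l.length) fun l u hu =>
      ((lt_of_forall_mem_list l).and ((hx u hu).eventually (ge_mem_nhds
        (by positivity)))).exists
  simp only [List.length_map, List.length_range] at hQ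
  -- Truncating `x (φ k)` itself at the disjoint levels restores signs. The error is doubled by the
  -- two parts, each with `2⁻ᵏ` from the truncation at `u k` and `2⁻ᵏ` from `r k`, whence 4.
  choose d hd hxd using fun k => exists_truncation (x (φ k))
    (posPart_nonneg (|x (φ k)| - u k - r k))
  refine ⟨φ, d, strictMono_of_forall_mem_map_range fun k => (hQ k).1,
    hdis.mono fun k => (hd k).trans (le_abs_self _), fun k => ?_⟩
  rw [hxd]
  refine (norm_posPart_sub_sub_le _).trans ?_
  have h1 : |x (φ k)| - (|x (φ k)| - u k - r k)⁺ ≤ |x (φ k)| ⊓ u k + r k := by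
    rw [sub_sub, sub_posPart_sub]
    exact inf_add_le_inf_add (hr0 k)
  have h0 : 0 ≤ |x (φ k)| ⊓ u k := le_inf (abs_nonneg _) (hu k)
  have h2 := norm_le_norm_of_nonneg_of_le (posPart_nonneg _)
    (sup_le h1 (add_nonneg h0 (hr0 k)))
  have h3 := norm_add_le (|x (φ k)| ⊓ u k) (r k)
  have h4 := (hQ k).2
  have h5 : ‖r k‖ ≤ (1 / 2) ^ k := by
    refine (hr k).trans (mul_le_of_le_one_left (by positivity) ?_)
    rw [mul_one_div]
    exact div_le_one_of_le₀ (by linarith) (by positivity)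
  linarith

/-- Operators vanishing along bounded disjoint sequences are approximated, on the unit ball, by
their values on order intervals. -/
theorem exists_orderInterval_approx [CompleteSpace E] {R : E →L[ℝ] E}
    (hR : ∀ d : ℕ → E, DisjointSeq d → (∀ n, ‖d n‖ ≤ 1) →
      Tendsto (fun n => ‖R (d n)‖) atTop (𝓝 0)) {ε : ℝ} (hε : 0 < ε) :
    ∃ u, 0 ≤ u ∧ ∀ x, ‖x‖ ≤ 1 → ∃ y, |y| ≤ u ∧ ‖R (x - y)‖ ≤ ε := by
  by_contra! hcon
  -- Disjointification needs positive vectors, so the positive or the negative part is kept, at the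
  -- price of half of `ε`.
  have hch : ∀ u, 0 ≤ u → ∃ x, (0 ≤ x ∧ ‖x‖ ≤ 1) ∧ ε / 2 < ‖R (x - u)⁺‖ := by
    intro u hu
    obtain ⟨x, hx, hxy⟩ := hcon u hu
    obtain ⟨y, hy, hyx⟩ := exists_truncation x hu
    have h1 := hxy y hy
    rw [hyx, map_sub] at h1
    have h2 := norm_sub_le (R (x⁺ - u)⁺) (R (x⁻ - u)⁺)
    by_cases h3 : ε / 2 < ‖R (x⁺ - u)⁺‖
    · exact ⟨x⁺, ⟨posPart_nonneg x, (norm_posPart_le x).trans hx⟩, h3⟩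
    · exact ⟨x⁻, ⟨negPart_nonneg x, (norm_negPart_le x).trans hx⟩, by linarith⟩
  have hε0 : 0 < ε / (4 * (‖R‖ + 1)) := by positivity
  obtain ⟨i, u, r, hu, hr0, hr, hQ, hdis⟩ := exists_disjointSeq_of_choice
    (ι := {x : E // 0 ≤ x ∧ ‖x‖ ≤ 1}) (x := Subtype.val) (C := 1) (fun i => i.2.1)
    (fun i => i.2.2) hε0 (Q := fun _ u i => ε / 2 < ‖R (i.1 - u)⁺‖)
    fun _ u hu => by
      obtain ⟨x, hx, h⟩ := hch u hu
      exact ⟨⟨x, hx⟩, h⟩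
  have hlim := hR _ hdis fun n => by
    refine (norm_le_norm_of_nonneg_of_le (posPart_nonneg _) ?_).trans (i n).2.2
    refine sup_le ?_ (i n).2.1
    rw [sub_sub]
    exact sub_le_self _ (add_nonneg (hu n) (hr0 n))
  refine absurd (ge_of_tendsto' hlim (b := ε / 4) fun n => ?_) (by linarith)
  have h1 : (↑(i n) - u n)⁺ - (↑(i n) - u n - r n)⁺ ≤ r n := by
    rw [sub_le_iff_le_add]
    refine sup_le ?_ (add_nonneg (hr0 n) (posPart_nonneg _))
    rw [← sub_le_iff_le_add']
    exact le_posPart _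
  have h2 : 0 ≤ (↑(i n) - u n)⁺ - (↑(i n) - u n - r n)⁺ :=
    sub_nonneg.2 (posPart_mono (sub_le_self _ (hr0 n)))
  have h3 := norm_le_norm_of_nonneg_of_le h2 h1
  have h4 := R.le_opNorm ((↑(i n) - u n)⁺ - (↑(i n) - u n - r n)⁺)
  rw [map_sub] at h4
  have h5 := norm_sub_norm_le (R (↑(i n) - u n)⁺) (R (↑(i n) - u n - r n)⁺)
  have h6 : ‖r n‖ ≤ ε / (4 * (‖R‖ + 1)) := by
    refine (hr n).trans ?_
    rw [one_mul]
    exact mul_le_of_le_one_right hε0.le (pow_le_one₀ (by norm_num) (by norm_num))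
  have h7 : ‖R‖ * ‖(↑(i n) - u n)⁺ - (↑(i n) - u n - r n)⁺‖ ≤ ε / 4 := by
    have := h3.trans h6
    rw [le_div_iff₀ (by positivity)] at this
    nlinarith [norm_nonneg ((↑(i n) - u n)⁺ - (↑(i n) - u n - r n)⁺)]
  have h8 := hQ n
  linarith

theorem isCompactOperator_of_totallyBounded_approx [CompleteSpace E] {R : E →L[ℝ] E}
    (h : ∀ ε > 0, ∃ K : Set E, TotallyBounded K ∧ ∀ x, ‖x‖ ≤ 1 → ∃ k ∈ K, ‖R x - k‖ ≤ ε) :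
    IsCompactOperator R := by
  refine (isCompactOperator_iff_isCompact_closure_image_closedBall (R : E →ₗ[ℝ] E) one_pos).2 ?_
  refine (TotallyBounded.closure ?_).isCompact_of_isClosed isClosed_closure
  rw [Metric.totallyBounded_iff]
  intro ε hε
  obtain ⟨K, hK, hRK⟩ := h (ε / 3) (by positivity)
  obtain ⟨t, ht, hKt⟩ := Metric.totallyBounded_iff.1 hK (ε / 3) (by positivity)
  refine ⟨t, ht, ?_⟩
  rintro _ ⟨x, hx, rfl⟩
  obtain ⟨k, hk, hxk⟩ := hRK x (mem_closedBall_zero_iff.1 hx)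
  obtain ⟨y, hy, hky⟩ := Set.mem_iUnion₂.1 (hKt hk)
  refine Set.mem_iUnion₂.2 ⟨y, hy, ?_⟩
  rw [Metric.mem_ball] at hky ⊢
  rw [← dist_eq_norm] at hxk
  have := dist_triangle (R x) k y
  change dist (R x) y < ε
  linarith

theorem IsDSS.not_forall_sum {S : E →L[ℝ] E} (hS : IsDSS S) {x : ℕ → E} (hx : ∀ n, x n ≠ 0)
    (hd : DisjointSeq x) {c : ℝ} (hc : 0 < c) :
    ¬ ∀ (N : ℕ) (a : ℕ → ℝ), c * ‖∑ n ∈ Finset.range N, a n • x n‖ ≤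
      ‖S (∑ n ∈ Finset.range N, a n • x n)‖ := by
  intro h
  refine hS x hx hd ⟨c, hc, fun v hv => ?_⟩
  have hcl : IsClosed {v : E | c * ‖v‖ ≤ ‖S v‖} :=
    isClosed_le (continuous_const.mul continuous_norm) S.continuous.norm
  refine closure_minimal (fun w hw => ?_) hcl hv
  obtain ⟨a, rfl⟩ := Finsupp.mem_span_range_iff_exists_finsupp.1 hw
  have hs : a.support ⊆ Finset.range (a.support.sup id + 1) := fun n hn =>
    Finset.mem_range.2 (Nat.lt_succ_of_le (Finset.le_sup (f := id) hn))
  rw [Finsupp.sum_of_support_subset a hs _ fun i _ => zero_smul ℝ (x i)]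
  exact h _ a

end Tools

/-! ### Compactness of `S ∘L T` when the dual norm is order continuous -/

section DualOrderContinuousCase

variable {E : Type*} [NormedAddCommGroup E] [NormedSpace ℝ E] [Lattice E]
  [IsOrderedAddMonoid E] [IsOrderedModule ℝ E] [HasSolidNorm E] [CompleteSpace E]

theorem sum_range_add_ite_smul {Z : Type*} [AddCommMonoid Z] [Module ℝ Z] (z : ℕ → Z)
    (a : ℕ → ℝ) (K N : ℕ) :
    ∑ n ∈ Finset.range (K + N), (if n < K then 0 else a (n - K)) • z n =
      ∑ n ∈ Finset.range N, a n • z (K + n) := by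
  rw [Finset.sum_range_add, Finset.sum_eq_zero, zero_add]
  · refine Finset.sum_congr rfl fun n _ => ?_
    rw [if_neg (by omega), Nat.add_sub_cancel_left]
  · intro n hn
    rw [if_pos (Finset.mem_range.1 hn), zero_smul]

theorem EquivSeq.shift {X Y : Type*} [NormedAddCommGroup X] [NormedSpace ℝ X]
    [NormedAddCommGroup Y] [NormedSpace ℝ Y] {C : ℝ} {x : ℕ → X} {y : ℕ → Y}
    (h : EquivSeq C x y) (K : ℕ) :
    EquivSeq C (fun k => x (K + k)) fun k => y (K + k) := fun N a => by
  have := h (K + N) fun n => if n < K then 0 else a (n - K)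
  rwa [sum_range_add_ite_smul, sum_range_add_ite_smul] at this

/-- For a positive operator `V` dominating `R`, each `F ∘L V` is again a positive functional, so `V
|d n|` is null against positive functionals and its truncations vanish in norm. -/
theorem IsRegularOp.tendsto_norm_abs_inf (hoc : OrderContinuousNorm E)
    (hdual : DualOrderContinuous E) {R : E →L[ℝ] E} (hR : IsRegularOp R) {d : ℕ → E}
    (hd : DisjointSeq d) {C : ℝ} (hC : ∀ n, ‖d n‖ ≤ C) {u : E} (hu : 0 ≤ u) :
    Tendsto (fun n => ‖|R (d n)| ⊓ u‖) atTop (𝓝 0) := by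
  obtain ⟨V, hV, hRV⟩ := hR.exists_dominating
  have h1 : Tendsto (fun n => ‖V |d n| ⊓ u‖) atTop (𝓝 0) := by
    refine hoc.tendsto_norm_inf (fun n => hV _ (abs_nonneg _)) (fun F hF => ?_) hu
    have hFV : IsPositiveMap (F ∘L V) := fun x hx => hF _ (hV x hx)
    exact hdual.tendsto_of_disjoint hFV (d := fun n => |d n|)
      (hd.mono fun n => by rw [abs_abs]) (fun n => abs_nonneg _)
      (fun n => by rw [norm_abs_eq_norm]; exact hC n)
  exact squeeze_zero (fun n => norm_nonneg _) (fun n => norm_le_norm_of_nonneg_of_le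
    (le_inf (abs_nonneg _) hu) (inf_le_inf_right u (hRV (d n)))) h1

/-- A disjoint sequence whose images are bounded away from zero and asymptotically disjoint
violates disjoint strict singularity in a disjointly homogeneous space. -/
theorem DisjointlyHomogeneous.not_isDSS (hDH : DisjointlyHomogeneous E) {S : E →L[ℝ] E}
    {e g : ℕ → E} (he : ∀ n, ‖e n‖ = 1) (hed : DisjointSeq e) (hgd : DisjointSeq g) {δ : ℝ}
    (hδ : 0 < δ) (hg : ∀ n, δ ≤ ‖g n‖) (heg : ∀ n, ‖S (e n) - g n‖ ≤ 4 * (1 / 2) ^ n) :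
    ¬ IsDSS S := by
  intro hS
  have hg0 : ∀ n, 0 < ‖g n‖ := fun n => hδ.trans_le (hg n)
  obtain ⟨C, hC, φ, hφ, hequiv⟩ := hDH e (fun n => ‖g n‖⁻¹ • g n) he
    (fun n => by rw [norm_smul, norm_inv, norm_norm, inv_mul_cancel₀ (hg0 n).ne']) hed
    (hgd.smul _)
  have hM : 0 < C * δ⁻¹ := by positivity
  -- Dropping `K` terms brings the total perturbation, at most `8 · 2⁻ᴷ ‖v‖`, down to a size that
  -- costs only `‖v‖ / 2` after multiplication by `C δ⁻¹` and can be absorbed.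
  obtain ⟨K, hK⟩ := exists_pow_lt_of_lt_one (show 0 < 1 / (16 * (C * δ⁻¹)) by positivity)
    (show (1 / 2 : ℝ) < 1 by norm_num)
  have hinj : Function.Injective fun k => φ (K + k) := fun i j hij =>
    Nat.add_left_cancel (hφ.injective hij)
  refine hS.not_forall_sum (x := fun k => e (φ (K + k))) (c := 1 / (2 * (C * δ⁻¹)))
    (fun n h => by have := he (φ (K + n)); simp [h] at this) (hed.comp hinj) (by positivity)
    fun N a => ?_
  set v := ∑ n ∈ Finset.range N, a n • e (φ (K + n)) with hv
  have h1 : ‖v‖ ≤ C * ‖∑ n ∈ Finset.range N, a n • (‖g (φ (K + n))‖⁻¹ • g (φ (K + n)))‖ :=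
    (hequiv.shift K N a).2
  have h2 : ‖∑ n ∈ Finset.range N, a n • (‖g (φ (K + n))‖⁻¹ • g (φ (K + n)))‖ ≤
      δ⁻¹ * ‖∑ n ∈ Finset.range N, a n • g (φ (K + n))‖ := by
    simp_rw [smul_smul]
    refine (hgd.comp hinj).norm_sum_le (x := fun n => g (φ (K + n))) (by positivity) _
      fun n _ => ?_
    rw [abs_mul, mul_comm, abs_of_pos (inv_pos.2 (hg0 _))]
    exact mul_le_mul_of_nonneg_right (inv_anti₀ hδ (hg _)) (abs_nonneg _)
  have h3 : ‖S v - ∑ n ∈ Finset.range N, a n • g (φ (K + n))‖ ≤ ‖v‖ * (8 * (1 / 2) ^ K) := by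
    rw [hv, map_sum, ← Finset.sum_sub_distrib]
    have hterm : ∀ n ∈ Finset.range N,
        ‖S (a n • e (φ (K + n))) - a n • g (φ (K + n))‖ ≤
          ‖v‖ * (4 * (1 / 2) ^ K) * (1 / 2) ^ n := fun n hn => by
      rw [map_smul, ← smul_sub, norm_smul]
      -- Disjointness bounds each coefficient by the norm of the whole sum.
      have ha : ‖a n‖ ≤ ‖v‖ := by
        have := (hed.comp hinj).norm_smul_le (x := fun n => e (φ (K + n))) a hn
        rwa [norm_smul, he, mul_one] at this
      have hb : ‖S (e (φ (K + n))) - g (φ (K + n))‖ ≤ 4 * (1 / 2) ^ K * (1 / 2) ^ n := by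
        refine (heg _).trans ?_
        rw [mul_assoc, ← pow_add]
        exact mul_le_mul_of_nonneg_left (pow_le_pow_of_le_one (by norm_num) (by norm_num)
          (hφ.le_apply)) (by norm_num)
      rw [mul_assoc]
      exact mul_le_mul ha hb (norm_nonneg _) (norm_nonneg _)
    refine (norm_sum_le_of_le _ hterm).trans ?_
    rw [← Finset.mul_sum]
    have hgeo : ∑ n ∈ Finset.range N, (1 / 2 : ℝ) ^ n ≤ 2 :=
      (summable_geometric_two.sum_le_tsum _ fun k _ => by positivity).trans_eq tsum_geometric_two
    have := mul_le_mul_of_nonneg_left hgeo (show 0 ≤ ‖v‖ * (4 * (1 / 2) ^ K) by positivity)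
    linarith
  have h4 : ‖v‖ * (8 * (1 / 2) ^ K) ≤ ‖v‖ * (1 / (2 * (C * δ⁻¹))) := by
    refine mul_le_mul_of_nonneg_left ?_ (norm_nonneg _)
    have : 1 / (2 * (C * δ⁻¹)) = 8 * (1 / (16 * (C * δ⁻¹))) := by
      field_simp
      norm_num
    rw [this]
    linarith
  have h5 : ‖∑ n ∈ Finset.range N, a n • g (φ (K + n))‖ ≤
      ‖S v‖ + ‖v‖ * (1 / (2 * (C * δ⁻¹))) := by
    have := norm_sub_norm_le (∑ n ∈ Finset.range N, a n • g (φ (K + n))) (S v)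
    rw [norm_sub_rev] at this
    linarith
  have h6 : ‖v‖ ≤ C * δ⁻¹ * (‖S v‖ + ‖v‖ * (1 / (2 * (C * δ⁻¹)))) := by
    refine h1.trans ?_
    rw [mul_assoc]
    exact mul_le_mul_of_nonneg_left (h2.trans (mul_le_mul_of_nonneg_left h5 (by positivity)))
      hC.le
  have h7 : C * δ⁻¹ * (‖S v‖ + ‖v‖ * (1 / (2 * (C * δ⁻¹)))) = C * δ⁻¹ * ‖S v‖ + ‖v‖ / 2 := by
    generalize C * δ⁻¹ = M at hM
    field_simp
  rw [h7] at h6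
  rw [one_div, inv_mul_le_iff₀ (by positivity)]
  linarith

theorem IsDSS.tendsto_norm_of_disjoint (hDH : DisjointlyHomogeneous E)
    (hoc : OrderContinuousNorm E) (hdual : DualOrderContinuous E) {S : E →L[ℝ] E}
    (hS : IsDSS S) (hSreg : IsRegularOp S) {d : ℕ → E} (hd : DisjointSeq d) {C : ℝ}
    (hC : ∀ n, ‖d n‖ ≤ C) : Tendsto (fun n => ‖S (d n)‖) atTop (𝓝 0) := by
  refine tendsto_zero_of_subseq (fun n => norm_nonneg _) fun φ hφ ε hε hbig => ?_
  have hd0 : ∀ n, 0 < ‖d (φ n)‖ := fun n => by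
    rw [norm_pos_iff]
    intro h
    have := hbig n
    rw [h, map_zero, norm_zero] at this
    linarith
  have hCpos : 0 < C := (hd0 0).trans_le (hC _)
  let e : ℕ → E := fun n => ‖d (φ n)‖⁻¹ • d (φ n)
  have he : ∀ n, ‖e n‖ = 1 := fun n => by
    rw [norm_smul, norm_inv, norm_norm, inv_mul_cancel₀ (hd0 n).ne']
  have hed : DisjointSeq e := (hd.comp hφ.injective).smul _
  have hSe : ∀ n, ε / C ≤ ‖S (e n)‖ := fun n => by
    rw [map_smul, norm_smul, norm_inv, norm_norm, inv_mul_eq_div]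
    exact div_le_div₀ (norm_nonneg _) (hbig n) (hd0 n) (hC _)
  obtain ⟨ψ, g, hψ, hg, hψg⟩ := exists_subseq_near_disjoint (x := fun n => S (e n)) (C := ‖S‖)
    (fun n => by simpa [he] using S.le_opNorm (e n))
    (fun u hu => hSreg.tendsto_norm_abs_inf hoc hdual hed (fun n => (he n).le) hu)
  have hδ : 0 < ε / C := by positivity
  -- Beyond `K` the approximation error `4 · 2⁻ᴷ` is below half of `ε / C`, so the disjoint
  -- approximants stay bounded away from zero.
  obtain ⟨K, hK⟩ := exists_pow_lt_of_lt_one (show 0 < ε / C / 8 by positivity)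
    (show (1 / 2 : ℝ) < 1 by norm_num)
  have hKn : ∀ n, (1 / 2 : ℝ) ^ (K + n) ≤ (1 / 2) ^ K := fun n =>
    pow_le_pow_of_le_one (by norm_num) (by norm_num) (by omega)
  have hKn' : ∀ n, (1 / 2 : ℝ) ^ (K + n) ≤ (1 / 2) ^ n := fun n =>
    pow_le_pow_of_le_one (by norm_num) (by norm_num) (by omega)
  refine hDH.not_isDSS (e := fun n => e (ψ (K + n))) (g := fun n => g (K + n)) (δ := ε / C / 2)
    (fun n => he _) (hed.comp fun i j hij => Nat.add_left_cancel (hψ.injective hij))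
    (hg.comp fun i j hij => Nat.add_left_cancel hij) (by positivity) (fun n => ?_)
    (fun n => ?_) hS
  · have h1 := hψg (K + n)
    have h2 := norm_sub_norm_le (S (e (ψ (K + n)))) (g (K + n))
    have h3 := hSe (ψ (K + n))
    have h4 := hKn n
    linarith
  · have h1 := hψg (K + n)
    have h4 := hKn' n
    linarith

theorem isCompactOperator_comp_of_dualOrderContinuous (hDH : DisjointlyHomogeneous E)
    (hoc : OrderContinuousNorm E) (hdual : DualOrderContinuous E) {S T : E →L[ℝ] E}
    (hSreg : IsRegularOp S) (hTreg : IsRegularOp T) (hS : IsDSS S) (hT : IsAMCompact T) :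
    IsCompactOperator (S ∘L T) := by
  have hM : ∀ d : ℕ → E, DisjointSeq d → (∀ n, ‖d n‖ ≤ 1) →
      Tendsto (fun n => ‖(S ∘L T) (d n)‖) atTop (𝓝 0) := by
    intro d hd hd1
    refine tendsto_zero_of_subseq (fun n => norm_nonneg _) fun φ hφ ε hε hbig => ?_
    have hTb : ∀ n, ‖T (d (φ n))‖ ≤ ‖T‖ := fun n =>
      (T.le_opNorm _).trans (mul_le_of_le_one_right (norm_nonneg _) (hd1 _))
    obtain ⟨ψ, g, hψ, hg, hψg⟩ := exists_subseq_near_disjoint (x := fun n => T (d (φ n))) hTb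
      (fun u hu => hTreg.tendsto_norm_abs_inf hoc hdual (hd.comp hφ.injective)
        (fun n => hd1 _) hu)
    have hgb : ∀ n, ‖g n‖ ≤ ‖T‖ + 4 := fun n => by
      have h1 := hψg n
      have h2 := norm_sub_norm_le (g n) (T (d (φ (ψ n))))
      rw [norm_sub_rev] at h2
      have h3 : (1 / 2 : ℝ) ^ n ≤ 1 := pow_le_one₀ (by norm_num) (by norm_num)
      have h4 := hTb (ψ n)
      linarith
    have hSg := hS.tendsto_norm_of_disjoint hDH hoc hdual hSreg hg hgb
    have hlim : Tendsto (fun n : ℕ => ‖S (g n)‖ + ‖S‖ * (4 * (1 / 2) ^ n)) atTop (𝓝 0) := by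
      have := hSg.add (((tendsto_pow_atTop_nhds_zero_of_lt_one (r := (1 / 2 : ℝ)) (by norm_num)
        (by norm_num)).const_mul 4).const_mul ‖S‖)
      simpa using this
    refine absurd (ge_of_tendsto' hlim (b := ε) fun n => ?_) (not_le.2 hε)
    refine (hbig (ψ n)).trans ?_
    have h1 := norm_sub_norm_le (S (T (d (φ (ψ n))))) (S (g n))
    rw [← map_sub] at h1
    have h2 := (S.le_opNorm (T (d (φ (ψ n))) - g n)).trans
      (mul_le_mul_of_nonneg_left (hψg n) (norm_nonneg _))
    change ‖S (T (d (φ (ψ n))))‖ ≤ _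
    linarith
  refine isCompactOperator_of_totallyBounded_approx fun ε hε => ?_
  obtain ⟨u, hu, huy⟩ := exists_orderInterval_approx hM hε
  refine ⟨S '' (T '' {y | |y| ≤ u}), ?_, fun x hx => ?_⟩
  · exact ((hT u hu).totallyBounded.subset subset_closure).image S.uniformContinuous
  · obtain ⟨y, hy, hxy⟩ := huy x hx
    refine ⟨_, ⟨_, ⟨y, hy, rfl⟩, rfl⟩, ?_⟩
    rwa [map_sub] at hxy

end DualOrderContinuousCase

/-! ### Compactness of `T ∘L S` when the dual norm is not order continuous -/

section DualNotOrderContinuousCase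

variable {E : Type*} [NormedAddCommGroup E] [NormedSpace ℝ E] [Lattice E]
  [IsOrderedAddMonoid E] [IsOrderedModule ℝ E] [HasSolidNorm E] [CompleteSpace E]

/-- If the dual norm is not order continuous, disjoint homogeneity makes every normalized disjoint
sequence have a subsequence equivalent to the `ℓ¹` basis. -/
theorem DisjointlyHomogeneous.exists_lowerL1 (hDH : DisjointlyHomogeneous E)
    (hdual : ¬ DualOrderContinuous E) {y : ℕ → E} (hy : ∀ n, ‖y n‖ = 1) (hyd : DisjointSeq y) :
    ∃ (φ : ℕ → ℕ) (c : ℝ), StrictMono φ ∧ 0 < c ∧ LowerL1 c (y ∘ φ) := by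
  obtain ⟨d, F, δ, hd, hd0, hd1, hF, hδ, hFd⟩ := exists_disjoint_of_not_dualOrderContinuous hdual
  have hpos : ∀ n, 0 < ‖d n‖ := fun n => by
    rw [norm_pos_iff]
    intro h
    have := hFd n
    rw [h, map_zero] at this
    linarith
  let z : ℕ → E := fun n => ‖d n‖⁻¹ • d n
  have hz : ∀ n, ‖z n‖ = 1 := fun n => by
    rw [norm_smul, norm_inv, norm_norm, inv_mul_cancel₀ (hpos n).ne']
  have hz0 : ∀ n, 0 ≤ z n := fun n => smul_nonneg (inv_nonneg.2 (hpos n).le) (hd0 n)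
  have hzd : DisjointSeq z := hd.smul _
  have hFz : ∀ n, δ ≤ F (z n) := fun n => by
    rw [map_smul, smul_eq_mul]
    exact (hFd n).trans (le_mul_of_one_le_left (hF _ (hd0 n))
      ((one_le_inv₀ (hpos n)).2 (hd1 n)))
  obtain ⟨C, hC, φ, hφ, h⟩ := hDH z y hz hy hzd hyd
  obtain ⟨hF0, hl⟩ := LowerL1.of_positive (d := z ∘ φ) (hzd.comp hφ.injective)
    (fun n => hz0 _) hF hδ fun n => hFz _
  refine ⟨φ, δ / ‖F‖ / C, hφ, by positivity, fun N a => ?_⟩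
  rw [div_mul_eq_mul_div, div_le_iff₀' hC]
  exact (hl N a).trans (h N a).2

/-- If disjoint vectors have images with uniformly large components under a summable family of
functionals, the operator is an isomorphism on the span of a subsequence. -/
theorem not_isDSS_of_components {S : E →L[ℝ] E} (hSreg : IsRegularOp S) {d : ℕ → E}
    (hd : DisjointSeq d) (hd1 : ∀ n, ‖d n‖ ≤ 1) {F : StrongDual ℝ E}
    {g : ℕ → StrongDual ℝ E} (hg0 : ∀ n, IsPositiveMap (g n))
    (hgF : ∀ (s : Finset ℕ) (x : E), 0 ≤ x → ∑ n ∈ s, g n x ≤ F x) {δ : ℝ} (hδ : 0 < δ)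
    (hgS : ∀ n, δ ≤ g n |S (d n)|) : ¬ IsDSS S := by
  intro hS
  obtain ⟨V, hV, hSV⟩ := hSreg.exists_dominating
  have hVd : ∀ k, 0 ≤ V |d k| := fun k => hV _ (abs_nonneg _)
  obtain ⟨φ, hφ, hoff⟩ := exists_subseq_offDiagonal_sum_le (a := fun j k => g j (V |d k|))
    (M := ‖F‖ * ‖V‖) (η := δ / 2) (fun j k => hg0 j _ (hVd k)) (fun s k => by
      refine (hgF s _ (hVd k)).trans ((le_abs_self _).trans ((F.le_opNorm _).trans ?_))
      refine mul_le_mul_of_nonneg_left ((V.le_opNorm _).trans ?_) (norm_nonneg _)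
      rw [norm_abs_eq_norm]
      exact mul_le_of_le_one_right (norm_nonneg _) (hd1 k)) (by positivity)
  have hne : ∀ n, d (φ n) ≠ 0 := fun n h => by
    have := hgS (φ n)
    rw [h, map_zero, abs_zero, map_zero] at this
    linarith
  refine hS.not_forall_sum (x := fun n => d (φ n)) (c := δ / (2 * (‖F‖ + 1))) hne
    (hd.comp hφ.injective) (by positivity) fun N a => ?_
  set v := ∑ n ∈ Finset.range N, a n • d (φ n) with hv
  -- The `j`-th term of `S v` is isolated and tested against its own functional. Summed over `j`,
  -- the off-diagonal part is at most half of the left side and is absorbed.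
  have hrow : ∀ j ∈ Finset.range N, |a j| * δ ≤ g (φ j) |S v| +
      ∑ k ∈ (Finset.range N).erase j, |a k| * g (φ j) (V |d (φ k)|) := by
    intro j hj
    have h1 : |a j| • |S (d (φ j))| ≤
        |S v| + ∑ k ∈ (Finset.range N).erase j, |a k| • V |d (φ k)| := by
      have e : a j • S (d (φ j)) =
          S v + -∑ k ∈ (Finset.range N).erase j, a k • S (d (φ k)) := by
        rw [hv, map_sum, ← Finset.add_sum_erase _ _ hj]
        simp only [map_smul]
        abel
      rw [← abs_smul_real, e]
      refine (abs_add_le _ _).trans (add_le_add le_rfl ?_)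
      rw [abs_neg]
      refine (abs_sum_le' _ _).trans (Finset.sum_le_sum fun k _ => ?_)
      rw [abs_smul_real]
      exact smul_le_smul_of_nonneg_left (hSV _) (abs_nonneg _)
    have h2 := (hg0 (φ j)).mono h1
    simp only [map_add, map_sum, map_smul, smul_eq_mul] at h2
    exact (mul_le_mul_of_nonneg_left (hgS (φ j)) (abs_nonneg _)).trans h2
  have hsum := Finset.sum_le_sum hrow
  rw [← Finset.sum_mul, Finset.sum_add_distrib] at hsum
  have hfirst : ∑ j ∈ Finset.range N, g (φ j) |S v| ≤ ‖F‖ * ‖S v‖ := by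
    have := hgF ((Finset.range N).map ⟨φ, hφ.injective⟩) _ (abs_nonneg (S v))
    rw [Finset.sum_map] at this
    refine this.trans ((le_abs_self _).trans ((F.le_opNorm _).trans_eq ?_))
    rw [norm_abs_eq_norm]
  have hsecond : ∑ j ∈ Finset.range N, ∑ k ∈ (Finset.range N).erase j,
      |a k| * g (φ j) (V |d (φ k)|) ≤ (∑ k ∈ Finset.range N, |a k|) * (δ / 2) := by
    rw [Finset.sum_comm' (t' := Finset.range N) (s' := fun k => (Finset.range N).erase k)
      (fun j k => by simp only [Finset.mem_erase]; tauto), Finset.sum_mul]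
    refine Finset.sum_le_sum fun k _ => ?_
    rw [← Finset.mul_sum]
    exact mul_le_mul_of_nonneg_left (hoff k _ (Finset.notMem_erase k _)) (abs_nonneg _)
  have hvle : ‖v‖ ≤ ∑ n ∈ Finset.range N, |a n| := by
    refine (norm_sum_le _ _).trans (Finset.sum_le_sum fun n _ => ?_)
    rw [norm_smul]
    exact mul_le_of_le_one_right (abs_nonneg _) (hd1 _)
  have h1 : δ / 2 * ‖v‖ ≤ ‖F‖ * ‖S v‖ := by nlinarith
  rw [div_mul_eq_mul_div, div_le_iff₀ (by positivity)]
  nlinarith [norm_nonneg (S v)]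

/-- Disjointification is used twice: on the images, to obtain an `ℓ¹` sequence and the components `f
n`, and then on the arguments, so that strict singularity can be contradicted through
`not_isDSS_of_components`. -/
theorem IsDSS.exists_almostOrderBound (hDH : DisjointlyHomogeneous E)
    (hdual : ¬ DualOrderContinuous E) {S : E →L[ℝ] E} (hSreg : IsRegularOp S) (hS : IsDSS S)
    {ε : ℝ} (hε : 0 < ε) : ∃ u, 0 ≤ u ∧ ∀ x, ‖x‖ ≤ 1 → ‖(|S x| - u)⁺‖ ≤ ε := by
  by_contra! hcon
  have hε0 : 0 < ε / (2 * (‖S‖ + 1)) := by positivity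
  obtain ⟨i, u, r, hu, hr0, hr, hQ, hdis⟩ := exists_disjointSeq_of_choice
    (ι := {x : E // ‖x‖ ≤ 1}) (x := fun i => |S i.1|) (C := ‖S‖) (fun i => abs_nonneg _)
    (fun i => by
      rw [norm_abs_eq_norm]
      exact (S.le_opNorm _).trans (mul_le_of_le_one_right (norm_nonneg _) i.2)) hε0
    (Q := fun _ u i => ε < ‖(|S i.1| - u)⁺‖) fun _ u hu => by
      obtain ⟨x, hx, h⟩ := hcon u hu
      exact ⟨⟨x, hx⟩, h⟩
  set z : ℕ → E := fun k => (|S (i k).1| - u k - r k)⁺ with hz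
  have hz0 : ∀ k, 0 ≤ z k := fun k => posPart_nonneg _
  have hzS : ∀ k, z k ≤ |S (i k).1| := fun k => by
    refine sup_le ?_ (abs_nonneg _)
    rw [sub_sub]
    exact sub_le_self _ (add_nonneg (hu k) (hr0 k))
  have hzε : ∀ k, ε / 2 ≤ ‖z k‖ := fun k => by
    have h1 : (|S (i k).1| - u k)⁺ ≤ z k + r k := by
      refine sup_le ?_ (add_nonneg (hz0 k) (hr0 k))
      rw [← sub_le_iff_le_add]
      exact le_posPart _
    have h2 := norm_le_norm_of_nonneg_of_le (posPart_nonneg _) h1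
    have h3 := norm_add_le (z k) (r k)
    have h4 : ‖r k‖ ≤ ε / 2 := by
      refine (hr k).trans ((mul_le_of_le_one_right (by positivity)
        (pow_le_one₀ (by norm_num) (by norm_num))).trans ?_)
      rw [← div_div, mul_div_assoc', div_le_iff₀ (by positivity)]
      nlinarith [norm_nonneg S]
    have h5 := hQ k
    linarith
  have hzpos : ∀ k, 0 < ‖z k‖ := fun k => (half_pos hε).trans_le (hzε k)
  obtain ⟨φ, c, hφ, hc, hl⟩ := hDH.exists_lowerL1 hdual (y := fun k => ‖z k‖⁻¹ • z k)
    (fun k => by rw [norm_smul, norm_inv, norm_norm, inv_mul_cancel₀ (hzpos k).ne'])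
    (hdis.smul _)
  have hyφ0 : ∀ n, 0 ≤ ((fun k => ‖z k‖⁻¹ • z k) ∘ φ) n := fun n =>
    smul_nonneg (inv_nonneg.2 (norm_nonneg _)) (hz0 _)
  obtain ⟨F, hF, hF1⟩ := hl.exists_positive hc hyφ0
  obtain ⟨f, hf0, hfz, hfs⟩ := exists_components hF hyφ0 ((hdis.smul _).comp hφ.injective)
  have hfS : ∀ n, ε / 2 ≤ f n |S (i (φ n)).1| := fun n => by
    have h1 := (hF1 n).trans_eq (hfz n).symm
    simp only [Function.comp, map_smul, smul_eq_mul] at h1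
    rw [inv_mul_eq_div, one_le_div (hzpos _)] at h1
    exact (hzε _).trans (h1.trans ((hf0 n).mono (hzS _)))
  have hw : ∀ n, ∃ w, 0 ≤ w ∧ ‖w‖ ≤ 1 ∧ ε / 4 ≤ f n |S w| := fun n => by
    set x := (i (φ n)).1
    have hx1 : ‖x‖ ≤ 1 := (i (φ n)).2
    have h1 : |S x| ≤ |S x⁺| + |S x⁻| := by
      have := abs_add_le (S x⁺) (-S x⁻)
      rwa [abs_neg, ← sub_eq_add_neg, ← map_sub, posPart_sub_negPart] at this
    have h2 := (hf0 n).mono h1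
    rw [map_add] at h2
    have h3 := hfS n
    by_cases h4 : ε / 4 ≤ f n |S x⁺|
    · exact ⟨x⁺, posPart_nonneg _, (norm_posPart_le x).trans hx1, h4⟩
    · exact ⟨x⁻, negPart_nonneg _, (norm_negPart_le x).trans hx1, by linarith⟩
  choose w hw0 hw1 hwS using hw
  obtain ⟨V, hV, hSV⟩ := hSreg.exists_dominating
  have hη : 0 < ε / 16 / (‖F ∘L V‖ + 1) := by positivity
  obtain ⟨j, p, q, hp, hq0, hq, hQ', hdis'⟩ := exists_disjointSeq_of_choice (x := w) (C := 1)
    -- The series of `f n (V p)` is bounded by `F (V p)`, so its terms tend to zero: a late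
    -- component barely sees the image of the earlier vectors.
    hw0 hw1 hη (Q := fun l p n => (∀ j ∈ l, j < n) ∧ f n (V p) ≤ ε / 16) fun l p hp => by
      have hlim : Tendsto (fun n => f n (V p)) atTop (𝓝 0) :=
        (summable_of_sum_le (fun n => hf0 n _ (hV p hp))
          fun s => hfs s _ (hV p hp)).tendsto_atTop_zero
      exact ((lt_of_forall_mem_list l).and (hlim.eventually (ge_mem_nhds
        (by positivity)))).exists
  have hj : StrictMono j := strictMono_of_forall_mem_map_range fun k => (hQ' k).1
  have hdw : ∀ k, (w (j k) - p k - q k)⁺ ≤ w (j k) := fun k => by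
    refine sup_le ?_ (hw0 _)
    rw [sub_sub]
    exact sub_le_self _ (add_nonneg (hp k) (hq0 k))
  refine not_isDSS_of_components hSreg hdis'
    (fun k => (norm_le_norm_of_nonneg_of_le (posPart_nonneg _) (hdw k)).trans (hw1 _))
    (F := F) (g := fun k => f (j k)) (fun k => hf0 _) (fun s x hx => ?_)
    -- From `ε / 4`, removing `p k` and `q k` costs at most `ε / 16` each.
    (δ := ε / 8) (by positivity) (fun k => ?_) hS
  · have := hfs (s.map ⟨j, hj.injective⟩) x hx
    rwa [Finset.sum_map] at this
  · set d := (w (j k) - p k - q k)⁺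
    have h1 : |w (j k) - d| ≤ p k + q k := by
      rw [abs_of_nonneg (sub_nonneg.2 (hdw k)), sub_sub, sub_posPart_sub]
      exact inf_le_right
    have h2 : |S (w (j k))| ≤ |S d| + V (p k + q k) := by
      have e : S (w (j k)) = S d + S (w (j k) - d) := by rw [← map_add, add_sub_cancel]
      rw [e]
      exact (abs_add_le _ _).trans (add_le_add le_rfl ((hSV _).trans (hV.mono h1)))
    have h3 := (hf0 (j k)).mono h2
    rw [map_add, map_add, map_add] at h3
    have h4 : f (j k) (V (q k)) ≤ (F ∘L V) (q k) := by
      simpa using hfs {j k} _ (hV _ (hq0 k))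
    have h5 := (le_abs_self _).trans ((F ∘L V).le_opNorm (q k))
    have h6 : ‖q k‖ ≤ ε / 16 / (‖F ∘L V‖ + 1) := by
      refine (hq k).trans ?_
      rw [one_mul]
      exact mul_le_of_le_one_right hη.le (pow_le_one₀ (by norm_num) (by norm_num))
    rw [le_div_iff₀ (by positivity)] at h6
    have h7 := (hQ' k).2
    have h8 := hwS (j k)
    nlinarith [norm_nonneg (q k)]

theorem isCompactOperator_comp_of_not_dualOrderContinuous (hDH : DisjointlyHomogeneous E)
    (hdual : ¬ DualOrderContinuous E) {S T : E →L[ℝ] E} (hSreg : IsRegularOp S) (hS : IsDSS S)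
    (hT : IsAMCompact T) : IsCompactOperator (T ∘L S) := by
  refine isCompactOperator_of_totallyBounded_approx fun ε hε => ?_
  obtain ⟨u, hu, hSu⟩ := hS.exists_almostOrderBound hDH hdual hSreg
    (show 0 < ε / (2 * (‖T‖ + 1)) by positivity)
  refine ⟨T '' {y | |y| ≤ u}, (hT u hu).totallyBounded.subset subset_closure, fun x hx => ?_⟩
  obtain ⟨y, hy, hxy⟩ := exists_truncation (S x) hu
  refine ⟨_, ⟨y, hy, rfl⟩, ?_⟩
  change ‖T (S x) - T y‖ ≤ ε
  rw [← map_sub]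
  refine (T.le_opNorm _).trans ?_
  have h1 := norm_posPart_sub_sub_le (S x) (c := u)
  rw [← hxy] at h1
  have h2 := hSu x hx
  rw [le_div_iff₀ (by positivity)] at h2
  nlinarith [norm_nonneg (S x - y), norm_nonneg T]

end DualNotOrderContinuousCase

end BanachLattice

theorem mainTheorem7 {E : Type*} [NormedAddCommGroup E] [NormedSpace ℝ E] [CompleteSpace E]
    [Lattice E] [IsOrderedAddMonoid E] [IsOrderedModule ℝ E] [HasSolidNorm E]
    (hDH : BanachLattice.DisjointlyHomogeneous E)
    (hoc : BanachLattice.OrderContinuousNorm E)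
    (hunit : ∃ e : E, BanachLattice.IsWeakUnit e)
    (S T : E →L[ℝ] E)
    (hSreg : BanachLattice.IsRegularOp S) (hTreg : BanachLattice.IsRegularOp T)
    (hS : BanachLattice.IsDSS S) (hT : BanachLattice.IsAMCompact T) :
    (BanachLattice.DualOrderContinuous E → IsCompactOperator (S ∘L T)) ∧
    (¬ BanachLattice.DualOrderContinuous E → IsCompactOperator (T ∘L S)) ∧
    (∀ R : E →L[ℝ] E, BanachLattice.IsDSS R → BanachLattice.IsRegularOp R →
      IsCompactOperator (S ∘L (T ∘L R))) := by
  refine ⟨fun h => BanachLattice.isCompactOperator_comp_of_dualOrderContinuous hDH hoc h hSreg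
    hTreg hS hT, fun h => BanachLattice.isCompactOperator_comp_of_not_dualOrderContinuous hDH h
    hSreg hS hT, fun R hR hRreg => ?_⟩
  -- The triple product contains a compact factor either way: `S ∘L T` in the first case, `T ∘L R`
  -- in the second.
  by_cases h : BanachLattice.DualOrderContinuous E
  · exact (BanachLattice.isCompactOperator_comp_of_dualOrderContinuous hDH hoc h hSreg hTreg hS
      hT).comp_clm R
  · exact (BanachLattice.isCompactOperator_comp_of_not_dualOrderContinuous hDH h hRreg hR
      hT).clm_comp S
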